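/- Let $n\ge 1$. A convex body in $\mathbb{R}^n$ is a compact convex set with non-empty interior; it is centered if its barycenter $\frac1{|K|}\int_K x\,dx$ is the origin, where $|\cdot|$ denotes Lebesgue volume. For a centered convex body $K\subseteq\mathbb{R}^n$ put $\|x\|_K=\inf\{t>0 : x\in tK\}$, $$\delta_K(\varepsilon)=\inf\Big\{1-\Big\|\frac{x+y}{2}\Big\|_K : \|x\|_K,\|y\|_K\le 1,\ \|x-y\|_K\ge\varepsilon\Big\}$$ (the modulus of convexity of $K$), and $$\Delta_{KB}(K)=\max_{x\in\mathbb{R}^n}\frac{|(K-x)\cap(x-K)|}{|K|}$$ (the Kövner–Besicovitch measure of symmetry of $K$). **Theorem.** Let $0<r<1$ and $0<\varepsilon<\sqrt2$, and let $K\subseteq\mathbb{R}^n$ be a centered convex body with $\delta_K(\varepsilon)\ge r$. Set $\alpha=1-\exp\left(-\frac{(\sqrt2-\varepsilon)^2}{4}\,n\right)$. Then $$\Delta_{KB}(K)\ \ge\ \alpha\,2^{-n}\left(\frac1{1-r}\right)^n\qquad\text{and}\qquad \frac{|K\cap(-K)|}{|K|}\ \ge\ \frac1{e\sqrt n}\,2^{-n}\left(\frac1{1-\alpha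 r}\right)^n .$$ -/

import Mathlib

open MeasureTheory Set Topology
open scoped Pointwise

/-- A convex body in `ℝⁿ`: a compact convex set with non-empty interior. -/
structure IsConvexBody {n : ℕ} (K : Set (EuclideanSpace ℝ (Fin n))) : Prop where
  convex : Convex ℝ K
  isCompact : IsCompact K
  interior_nonempty : (interior K).Nonempty

/-- The barycenter `b(K) = |K|⁻¹ ∫_K x dx`. A convex body is centered if it is `0`. -/
noncomputable def barycenter {n : ℕ} (K : Set (EuclideanSpace ℝ (Fin n))) :
    EuclideanSpace ℝ (Fin n) :=
  ⨍ x in K, x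

/-- The modulus of convexity `δ_K(ε)`, the infimum of `1 - ‖(x + y) / 2‖_K` over all `x, y` with
`‖x‖_K, ‖y‖_K ≤ 1` and `‖x - y‖_K ≥ ε`, where `‖x‖_K = inf {t > 0 : x ∈ t K}` is `gauge K x`. -/
noncomputable def modulusOfConvexity {n : ℕ} (K : Set (EuclideanSpace ℝ (Fin n))) (ε : ℝ) : ℝ :=
  sInf {d : ℝ | ∃ x y : EuclideanSpace ℝ (Fin n), gauge K x ≤ 1 ∧ gauge K y ≤ 1 ∧
    ε ≤ gauge K (x - y) ∧ d = 1 - gauge K ((1 / 2 : ℝ) • (x + y))}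

/-- The relative volume `|(K - x) ∩ (x - K)| / |K|` of the symmetric intersection of `K` at `x`. -/
noncomputable def symmRatio {n : ℕ} (K : Set (EuclideanSpace ℝ (Fin n)))
    (x : EuclideanSpace ℝ (Fin n)) : ℝ :=
  volume.real ((K - {x}) ∩ ({x} - K)) / volume.real K

/-- The Kövner-Besicovitch measure of symmetry. The supremum is a maximum for convex bodies, see
`IsConvexBody.isGreatest_kovnerBesicovitch`. -/
noncomputable def kovnerBesicovitch {n : ℕ} (K : Set (EuclideanSpace ℝ (Fin n))) : ℝ :=
  sSup (range (symmRatio K))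

theorem mem_symmInter {n : ℕ} {K : Set (EuclideanSpace ℝ (Fin n))}
    {x y : EuclideanSpace ℝ (Fin n)} :
    y ∈ (K - {x}) ∩ ({x} - K) ↔ y + x ∈ K ∧ x - y ∈ K := by
  simp only [mem_inter_iff, Set.mem_sub, mem_singleton_iff, exists_eq_left]
  constructor
  · rintro ⟨⟨a, ha, rfl⟩, ⟨b, hb, h⟩⟩
    refine ⟨by simpa using ha, ?_⟩
    rw [← h]; simpa using hb
  · rintro ⟨h1, h2⟩
    exact ⟨⟨_, h1, by abel⟩, ⟨_, h2, by abel⟩⟩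

theorem IsConvexBody.isGreatest_kovnerBesicovitch {n : ℕ}
    {K : Set (EuclideanSpace ℝ (Fin n))} (hK : IsConvexBody K) :
    IsGreatest (range (symmRatio K)) (kovnerBesicovitch K) := by
  have hKc := hK.isCompact
  have hKne : K.Nonempty := hK.interior_nonempty.mono interior_subset
  set S : EuclideanSpace ℝ (Fin n) → Set (EuclideanSpace ℝ (Fin n)) :=
    fun x => (K - {x}) ∩ ({x} - K) with hS
  have hSc : ∀ x, IsCompact (S x) := fun x => by
    simp only [hS, sub_eq_add_neg]
    exact (hKc.add isCompact_singleton.neg).inter (isCompact_singleton.add hKc.neg)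
  -- upper semicontinuity of the volume of the symmetric intersection
  have husc : UpperSemicontinuous fun x => volume (S x) := by
    intro x₀ c hc
    obtain ⟨U, hSU, hUo, hUc⟩ := (S x₀).exists_isOpen_lt_of_lt c hc
    -- the pairs `(x, z)` with `2x - z ∈ K` and `z - x ∉ U` form a closed set
    have hcl : IsClosed {p : EuclideanSpace ℝ (Fin n) × EuclideanSpace ℝ (Fin n) |
        p.1 + p.1 - p.2 ∈ K ∧ p.2 - p.1 ∉ U} := by
      refine IsClosed.inter (hKc.isClosed.preimage (by fun_prop)) ?_
      exact (hUo.isClosed_compl).preimage (f := fun p : EuclideanSpace ℝ (Fin n) ×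
        EuclideanSpace ℝ (Fin n) => p.2 - p.1) (by fun_prop)
    have hev : ∀ᶠ x in 𝓝 x₀, ∀ z ∈ K,
        (x, z) ∈ {p : EuclideanSpace ℝ (Fin n) × EuclideanSpace ℝ (Fin n) |
          p.1 + p.1 - p.2 ∈ K ∧ p.2 - p.1 ∉ U}ᶜ := by
      refine hKc.eventually_forall_of_forall_eventually fun z hz => ?_
      refine hcl.isOpen_compl.mem_nhds ?_
      rintro ⟨h1, h2⟩
      refine h2 (hSU (mem_symmInter.2 ⟨by simpa using hz, ?_⟩))
      have : x₀ - (z - x₀) = x₀ + x₀ - z := by abel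
      rwa [this]
    filter_upwards [hev] with x hx
    refine lt_of_le_of_lt (measure_mono fun y hy => ?_) hUc
    obtain ⟨h1, h2⟩ := mem_symmInter.1 hy
    by_contra hyU
    refine hx _ h1 ⟨?_, ?_⟩
    · have : x + x - (y + x) = x - y := by abel
      simpa [this] using h2
    · simpa using hyU
  obtain ⟨a, -, ha⟩ := (husc.upperSemicontinuousOn K).exists_isMaxOn hKne hKc
  have hmax : ∀ x, volume (S x) ≤ volume (S a) := by
    intro x
    rcases (S x).eq_empty_or_nonempty with h | ⟨y, hy⟩
    · simp [h]
    · refine ha ?_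
      obtain ⟨h1, h2⟩ := mem_symmInter.1 hy
      have h := hK.convex h1 h2 (a := 1 / 2) (b := 1 / 2) (by norm_num) (by norm_num) (by norm_num)
      have : (1 / 2 : ℝ) • (y + x) + (1 / 2 : ℝ) • (x - y) = x := by module
      rwa [this] at h
  have hg : IsGreatest (range (symmRatio K)) (symmRatio K a) := by
    refine ⟨mem_range_self a, ?_⟩
    rintro _ ⟨x, rfl⟩
    exact div_le_div_of_nonneg_right
      (ENNReal.toReal_mono (hSc a).measure_lt_top.ne (hmax x)) measureReal_nonneg
  have : kovnerBesicovitch K = symmRatio K a := hg.csSup_eq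
  rwa [this]

/-! Let X and Y be independent uniform points of K and Z = (X + Y)/2. The change of variables y = 2z
- x shows that Z has density φ(z) = 2ⁿ |(K - z) ∩ (z - K)| / |K|² (`map_midpoint_prod_restrict`).
Both bounds combine this formula with one fact: ‖X - Y‖_K ≥ ε with probability at least α, and on
that event the modulus of convexity forces ‖Z‖_K ≤ 1 - r.

The probability estimate (`prod_restrict_gauge_sub_lt_le`) is the sharp Young inequality applied to
the indicators of K, K and εK. With w = ε²/2 the exponents are 1/(2-w), 1/(2-w) and 2(1-w)/(2-w),
which sum to 2, and the constant leaves exactly √(w(2-w))ⁿ |K|². Young's inequality is proved in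
dimension one by monotone transport to Gaussians, where weighted AM-GM controls the Jacobian, and is
then tensorised (`young_lintegral_pi`).

First bound (`le_kovnerBesicovitch`): α ≤ P(Z ∈ (1-r)K), while φ is at most 2ⁿ Δ_KB(K) / |K| and
(1-r)K has volume (1-r)ⁿ |K|.

Second bound (`log_le_log_volume_symmInter`): by Prékopa-Leindler φ is log-concave, so log φ(z) ≤
log φ(0) + ℓ(z) with ℓ linear, and E ℓ(Z) = 0 because K is centered. Gibbs' inequality against the
density proportional to exp(-c‖z‖_K) gives log φ(0) ≥ log(cⁿ / (n! |K|)) - c E‖Z‖_K. Since E‖Z‖_K ≤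
1 - αr (`integral_gauge_midpoint_le`), the choice c = n/(1 - αr) and Stirling's bound for n!
conclude. -/

/-! ### Monotone transport of densities on the line to a Gaussian. -/

section Transport

open scoped ENNReal

/-- The distribution function of the probability measure on `ℝ` with density `f`. -/
noncomputable def densityCDF (f : ℝ → ℝ≥0∞) (x : ℝ) : ℝ :=
  (∫⁻ t in Iic x, f t).toReal

theorem densityCDF_eq_cdf {f : ℝ → ℝ≥0∞} (h1 : ∫⁻ x, f x = 1) (x : ℝ) :
    densityCDF f x = ProbabilityTheory.cdf (volume.withDensity f) x := by
  have : IsProbabilityMeasure (volume.withDensity f) := ⟨by simp [h1]⟩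
  rw [ProbabilityTheory.cdf_eq_real, measureReal_def, withDensity_apply _ measurableSet_Iic]
  rfl

theorem densityCDF_mono {f : ℝ → ℝ≥0∞} (h1 : ∫⁻ x, f x = 1) : Monotone (densityCDF f) := by
  intro x y hxy
  simp only [densityCDF_eq_cdf h1]
  exact ProbabilityTheory.monotone_cdf _ hxy

theorem densityCDF_nonneg (f : ℝ → ℝ≥0∞) (x : ℝ) : 0 ≤ densityCDF f x := ENNReal.toReal_nonneg

theorem densityCDF_le_one {f : ℝ → ℝ≥0∞} (h1 : ∫⁻ x, f x = 1) (x : ℝ) : densityCDF f x ≤ 1 := by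
  rw [densityCDF_eq_cdf h1]
  exact ProbabilityTheory.cdf_le_one _ _

theorem integrable_toReal_density {f : ℝ → ℝ≥0∞} (hf : Measurable f) (h1 : ∫⁻ x, f x = 1) :
    Integrable fun x => (f x).toReal :=
  integrable_toReal_of_lintegral_ne_top hf.aemeasurable (by simp [h1])

theorem densityCDF_eq_integral {f : ℝ → ℝ≥0∞} (hf : Measurable f) (h1 : ∫⁻ x, f x = 1) (x : ℝ) :
    densityCDF f x = densityCDF f 0 + ∫ t in (0 : ℝ)..x, (f t).toReal := by
  have hi := integrable_toReal_density hf h1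
  have hfin : ∀ᵐ x, f x < ∞ := ae_lt_top hf (by simp [h1])
  have key : ∀ y, densityCDF f y = ∫ t in Iic y, (f t).toReal := fun y => by
    rw [integral_toReal hf.aemeasurable (ae_restrict_of_ae hfin)]
    rfl
  rw [key, key, ← intervalIntegral.integral_Iic_sub_Iic hi.integrableOn hi.integrableOn]
  ring

/-- Lebesgue differentiation; as `f` is only measurable, the transport map can be differentiated
only off a null set. -/
theorem densityCDF_ae_hasDerivAt {f : ℝ → ℝ≥0∞} (hf : Measurable f) (h1 : ∫⁻ x, f x = 1) :
    ∀ᵐ x, HasDerivAt (densityCDF f) (f x).toReal x := by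
  filter_upwards [LocallyIntegrable.ae_hasDerivAt_integral
      (integrable_toReal_density hf h1).locallyIntegrable]
    with x hx
  refine ((hx 0).const_add (densityCDF f 0)).congr_of_eventuallyEq ?_
  exact Filter.Eventually.of_forall fun y => densityCDF_eq_integral hf h1 y

/-- The standard Gaussian density normalised as `exp (-π x²)`. -/
noncomputable def gaussDensity (x : ℝ) : ℝ := Real.exp (-(Real.pi * x ^ 2))

theorem gaussDensity_pos (x : ℝ) : 0 < gaussDensity x := Real.exp_pos _

theorem continuous_gaussDensity : Continuous gaussDensity := by
  unfold gaussDensity; fun_prop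

theorem lintegral_gaussDensity : ∫⁻ x, ENNReal.ofReal (gaussDensity x) = 1 := by
  have h := integral_gaussian Real.pi
  have hi := integrable_exp_neg_mul_sq Real.pi_pos
  have e : (fun x : ℝ => Real.exp (-Real.pi * x ^ 2)) = gaussDensity := by
    ext x; simp [gaussDensity]
  rw [e] at h hi
  rw [← ofReal_integral_eq_lintegral_ofReal hi
    (Filter.Eventually.of_forall fun x => (gaussDensity_pos x).le), h]
  simp [Real.pi_ne_zero]

/-- The distribution function of the Gaussian density. -/
noncomputable def gaussCDF : ℝ → ℝ := densityCDF fun x => ENNReal.ofReal (gaussDensity x)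

theorem hasStrictDerivAt_gaussCDF (x : ℝ) : HasStrictDerivAt gaussCDF (gaussDensity x) x := by
  have hm : Measurable fun x => ENNReal.ofReal (gaussDensity x) :=
    continuous_gaussDensity.measurable.ennreal_ofReal
  have h := intervalIntegral.integral_hasStrictDerivAt_right (a := 0) (b := x)
    (continuous_gaussDensity.intervalIntegrable _ _)
    (continuous_gaussDensity.stronglyMeasurableAtFilter _ _) continuous_gaussDensity.continuousAt
  refine (h.const_add (gaussCDF 0)).congr_of_eventuallyEq ?_
  refine Filter.Eventually.of_forall fun y => ?_
  rw [gaussCDF, densityCDF_eq_integral hm lintegral_gaussDensity y]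
  simp [ENNReal.toReal_ofReal (gaussDensity_pos _).le]

theorem strictMono_gaussCDF : StrictMono gaussCDF :=
  strictMono_of_deriv_pos fun x => by
    rw [(hasStrictDerivAt_gaussCDF x).hasDerivAt.deriv]; exact gaussDensity_pos x

theorem exists_gaussCDF_eq {p : ℝ} (h0 : 0 < p) (h1 : p < 1) : ∃ x, gaussCDF x = p := by
  have e : gaussCDF = ProbabilityTheory.cdf
      (volume.withDensity fun x => ENNReal.ofReal (gaussDensity x)) :=
    funext fun x => densityCDF_eq_cdf lintegral_gaussDensity x
  obtain ⟨a, ha⟩ := ((ProbabilityTheory.tendsto_cdf_atBot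
    (volume.withDensity fun x => ENNReal.ofReal (gaussDensity x))).eventually_lt_const h0).exists
  obtain ⟨b, hb⟩ := ((ProbabilityTheory.tendsto_cdf_atTop
    (volume.withDensity fun x => ENNReal.ofReal (gaussDensity x))).eventually_const_lt h1).exists
  rw [← e] at ha hb
  have hc : Continuous gaussCDF :=
    continuous_iff_continuousAt.2 fun x => (hasStrictDerivAt_gaussCDF x).hasDerivAt.continuousAt
  exact mem_range_of_exists_le_of_exists_ge hc ⟨a, ha.le⟩ ⟨b, hb.le⟩

/-- Monotone transport of a probability density on `ℝ` to the Gaussian density. -/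
theorem exists_transport {f : ℝ → ℝ≥0∞} (hf : Measurable f) (h1 : ∫⁻ x, f x = 1) :
    ∃ (T : ℝ → ℝ) (D : Set ℝ), MeasurableSet D ∧ (∀ᵐ x, x ∉ D → f x = 0) ∧ StrictMonoOn T D ∧
      ∀ x ∈ D, 0 < deriv T x ∧ DifferentiableAt ℝ T x ∧
        f x = ENNReal.ofReal (deriv T x * gaussDensity (T x)) := by
  set F := densityCDF f with hF
  set Ginv := Function.invFun gaussCDF with hGinv
  have hleft : ∀ x, Ginv (gaussCDF x) = x :=
    Function.leftInverse_invFun strictMono_gaussCDF.injective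
  -- A measurable null set containing all bad points, so that `D` is measurable.
  set N := toMeasurable volume {x | ¬ (HasDerivAt F (f x).toReal x ∧ f x < ∞)} with hN
  have hN0 : volume N = 0 := by
    rw [hN, measure_toMeasurable]
    have := (densityCDF_ae_hasDerivAt hf h1).and (ae_lt_top hf (by simp [h1]))
    exact this
  have hgood : ∀ x ∉ N, HasDerivAt F (f x).toReal x ∧ f x < ∞ := fun x hx => by
    by_contra h
    exact hx (subset_toMeasurable _ _ h)
  set D := {x | f x ≠ 0} \ N with hD
  have hDpos : ∀ x ∈ D, 0 < (f x).toReal := fun x hx =>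
    ENNReal.toReal_pos hx.1 (hgood x hx.2).2.ne
  have hGT : ∀ x ∈ D, gaussCDF (Ginv (F x)) = F x := fun x hx => by
    have hd := (hgood x hx.2).1
    -- A point where `F` takes the value 0 or 1 is a global extremum of `F`, which is impossible
    -- where its derivative `f x` is positive. So `F x` lies in the range of `gaussCDF`.
    have h0 : F x ≠ 0 := fun h => (hDpos x hx).ne' <|
      IsLocalMin.hasDerivAt_eq_zero (f := F) (Filter.Eventually.of_forall fun y => by
        rw [h]; exact densityCDF_nonneg f y) hd
    have h1' : F x ≠ 1 := fun h => (hDpos x hx).ne' <|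
      IsLocalMax.hasDerivAt_eq_zero (f := F) (Filter.Eventually.of_forall fun y => by
        rw [h]; exact densityCDF_le_one h1 y) hd
    exact Function.invFun_eq (exists_gaussCDF_eq ((densityCDF_nonneg f x).lt_of_ne' h0)
      ((densityCDF_le_one h1 x).lt_of_ne h1'))
  refine ⟨fun x => Ginv (F x), D, (hf (measurableSet_singleton 0)).compl.diff
    (measurableSet_toMeasurable _ _), ?_, ?_, ?_⟩
  · filter_upwards [measure_eq_zero_iff_ae_notMem.1 hN0] with x hx hxD
    by_contra h
    exact hxD ⟨h, hx⟩
  · intro x hx y hy hxy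
    rw [← strictMono_gaussCDF.lt_iff_lt, hGT x hx, hGT y hy]
    -- If `F` did not increase from `x` to `y`, monotonicity would make `x` a local maximum, against
    -- the positive derivative.
    by_contra hle
    refine (hDpos x hx).ne' (IsLocalMax.hasDerivAt_eq_zero (f := F) ?_ (hgood x hx.2).1)
    filter_upwards [Iio_mem_nhds hxy] with z hz
    exact (densityCDF_mono h1 (le_of_lt hz)).trans (not_lt.1 hle)
  · intro x hx
    have hG := (hasStrictDerivAt_gaussCDF (Ginv (F x))).to_local_left_inverse
      (gaussDensity_pos _).ne' (Filter.Eventually.of_forall hleft)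
    rw [hGT x hx] at hG
    have hd := hG.hasDerivAt.comp x (hgood x hx.2).1
    have hd' : HasDerivAt (fun x => Ginv (F x))
      ((gaussDensity (Ginv (F x)))⁻¹ * (f x).toReal) x := hd
    rw [hd'.deriv]
    refine ⟨mul_pos (inv_pos.2 (gaussDensity_pos _)) (hDpos x hx), hd'.differentiableAt, ?_⟩
    rw [mul_right_comm, inv_mul_cancel₀ (gaussDensity_pos _).ne', one_mul,
      ENNReal.ofReal_toReal (hgood x hx.2).2.ne]

end Transport

/-! ### The sharp Young inequality for probability densities on the line. -/

section YoungOneDim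

open scoped ENNReal

/-- The two quadratic forms in the exponents differ by a multiple of the square of `T - U - √(2 * w)
* W`. This vanishes for the Gaussian extremisers, where the third density is dilated by `√(2 * w)`,
so nothing is lost in the constant. -/
theorem gaussDensity_mul_le {w : ℝ} (hw0 : 0 < w) (hw1 : w < 1) (T U W : ℝ) :
    gaussDensity T ^ (1 / (2 - w)) * gaussDensity U ^ (1 / (2 - w)) *
      gaussDensity W ^ (2 * ((1 - w) / (2 - w))) ≤
    gaussDensity (√(1 / (2 * (2 - w))) * (T + U)) *
      gaussDensity (√(w / (2 * (2 - w) ^ 2)) * (T - U + 4 * (1 - w) / √(2 * w) * W)) := by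
  have h2 : 0 < 2 - w := by linarith
  have hs : 0 < √(2 * w) := Real.sqrt_pos.2 (by linarith)
  have hss : √(2 * w) ^ 2 = 2 * w := Real.sq_sqrt (by linarith)
  simp only [gaussDensity, ← Real.exp_mul, ← Real.exp_add]
  rw [Real.exp_le_exp, mul_pow, mul_pow, Real.sq_sqrt (by positivity), Real.sq_sqrt (by positivity)]
  have key : 1 / (2 - w) * T ^ 2 + 1 / (2 - w) * U ^ 2 + 2 * ((1 - w) / (2 - w)) * W ^ 2
      - (1 / (2 * (2 - w)) * (T + U) ^ 2
        + w / (2 * (2 - w) ^ 2) * (T - U + 4 * (1 - w) / √(2 * w) * W) ^ 2)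
      = (1 - w) / (2 - w) ^ 2 * (T - U - √(2 * w) * W) ^ 2 := by
    have hw : w = √(2 * w) ^ 2 / 2 := by rw [hss]; ring
    generalize √(2 * w) = t at *
    subst hw
    field_simp
    ring
  have hnn : 0 ≤ (1 - w) / (2 - w) ^ 2 * (T - U - √(2 * w) * W) ^ 2 := by
    have : 0 < 1 - w := by linarith
    positivity
  have := mul_nonneg Real.pi_pos.le (key ▸ hnn)
  linarith

/-- Weighted AM-GM for `T * U`, `√(2 * w) * W * T` and `√(2 * w) * W * U` with weights w/(2-w),
(1-w)/(2-w), (1-w)/(2-w). Here `T`, `U`, `W` stand for derivatives of transport maps, and the right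
side contains the Jacobian of the plane map built from them. -/
theorem jacobian_lower_bound {w : ℝ} (hw0 : 0 < w) (hw1 : w < 1) {T U W : ℝ} (hT : 0 < T)
    (hU : 0 < U) (hW : 0 < W) :
    T ^ (1 / (2 - w)) * U ^ (1 / (2 - w)) * W ^ (2 * ((1 - w) / (2 - w))) ≤
      √(w * (2 - w)) / √(2 * w) ^ (2 * ((1 - w) / (2 - w))) *
        (√(1 / (2 * (2 - w))) * √(w / (2 * (2 - w) ^ 2)) *
          (2 * T * U + 4 * (1 - w) / √(2 * w) * W * (T + U))) := by
  have h2 : 0 < 2 - w := by linarith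
  have h1w : 0 < 1 - w := by linarith
  have hs : 0 < √(2 * w) := Real.sqrt_pos.2 (by linarith)
  have hss : √(2 * w) ^ 2 = 2 * w := Real.sq_sqrt (by linarith)
  have hroot : √(w * (2 - w)) * (√(1 / (2 * (2 - w))) * √(w / (2 * (2 - w) ^ 2)))
      = w / (2 * (2 - w)) := by
    rw [← Real.sqrt_mul (by positivity), ← Real.sqrt_mul (by positivity)]
    rw [Real.sqrt_eq_iff_mul_self_eq (by positivity) (by positivity)]
    field_simp
  have hamgm := Real.geom_mean_le_arith_mean3_weighted (w₁ := w / (2 - w))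
    (w₂ := (1 - w) / (2 - w)) (w₃ := (1 - w) / (2 - w)) (p₁ := T * U) (p₂ := √(2 * w) * W * T)
    (p₃ := √(2 * w) * W * U) (by positivity) (by positivity) (by positivity) (by positivity)
    (by positivity) (by positivity) (by field_simp; ring)
  have hsum : w / (2 - w) + (1 - w) / (2 - w) = 1 / (2 - w) := by field_simp; ring
  have hlhs : (T * U) ^ (w / (2 - w)) * (√(2 * w) * W * T) ^ ((1 - w) / (2 - w)) *
      (√(2 * w) * W * U) ^ ((1 - w) / (2 - w)) = √(2 * w) ^ (2 * ((1 - w) / (2 - w))) *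
      (T ^ (1 / (2 - w)) * U ^ (1 / (2 - w)) * W ^ (2 * ((1 - w) / (2 - w)))) := by
    have hdouble : ∀ z : ℝ, 0 < z → z ^ (2 * ((1 - w) / (2 - w))) =
        z ^ ((1 - w) / (2 - w)) * z ^ ((1 - w) / (2 - w)) := fun z hz => by
      rw [two_mul ((1 - w) / (2 - w)), Real.rpow_add hz]
    rw [Real.mul_rpow hT.le hU.le, Real.mul_rpow (by positivity) hT.le,
      Real.mul_rpow (by positivity) hU.le, Real.mul_rpow hs.le hW.le, ← hsum, Real.rpow_add hT,
      Real.rpow_add hU, hdouble _ hs, hdouble _ hW]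
    ring
  rw [hlhs] at hamgm
  have hpow : 0 < √(2 * w) ^ (2 * ((1 - w) / (2 - w))) := Real.rpow_pos_of_pos hs _
  rw [div_mul_eq_mul_div, le_div_iff₀ hpow, mul_comm _ (√(2 * w) ^ _), ← mul_assoc (√(w * (2 - w))),
    hroot]
  refine hamgm.trans (le_of_eq ?_)
  have hw : w = √(2 * w) ^ 2 / 2 := by rw [hss]; ring
  generalize √(2 * w) = t at *
  subst hw
  field_simp
  ring

/-- The sharp Young inequality on `ℝ` for densities, in the form used to compare three copies of
one body. -/
theorem young_lintegral_of_lintegral_eq_one {w : ℝ} (hw0 : 0 < w) (hw1 : w < 1) {f g h : ℝ → ℝ≥0∞}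
    (hf : Measurable f) (hg : Measurable g) (hh : Measurable h) (hf1 : ∫⁻ x, f x = 1)
    (hg1 : ∫⁻ x, g x = 1) (hh1 : ∫⁻ x, h x = 1) :
    ∫⁻ x, ∫⁻ y, f x ^ (1 / (2 - w)) * g y ^ (1 / (2 - w)) *
        h (x - y) ^ (2 * ((1 - w) / (2 - w))) ≤
      ENNReal.ofReal (√(w * (2 - w)) / √(2 * w) ^ (2 * ((1 - w) / (2 - w)))) := by
  have h2 : 0 < 2 - w := by linarith
  have h1w : 0 < 1 - w := by linarith
  have hs : 0 < √(2 * w) := Real.sqrt_pos.2 (by linarith)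
  set a := 1 / (2 - w) with ha
  set q := 2 * ((1 - w) / (2 - w)) with hq
  have ha0 : 0 < a := by positivity
  have hq0 : 0 < q := by positivity
  set K := √(w * (2 - w)) / √(2 * w) ^ q with hK
  have hK0 : 0 ≤ K := by positivity
  set c₁ := √(1 / (2 * (2 - w))) with hc₁
  set c₂ := √(w / (2 * (2 - w) ^ 2)) with hc₂
  have hc₁0 : 0 < c₁ := Real.sqrt_pos.2 (by positivity)
  have hc₂0 : 0 < c₂ := Real.sqrt_pos.2 (by positivity)
  set b := 4 * (1 - w) / √(2 * w) with hb
  have hb0 : 0 < b := by positivity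
  obtain ⟨T, Df, hDfm, hDf, hTm, hT⟩ := exists_transport hf hf1
  obtain ⟨U, Dg, hDgm, hDg, hUm, hU⟩ := exists_transport hg hg1
  obtain ⟨W, Dh, hDhm, hDh, hWm, hW⟩ := exists_transport hh hh1
  set D : Set (ℝ × ℝ) := {p | p.1 ∈ Df ∧ p.2 ∈ Dg ∧ p.1 - p.2 ∈ Dh} with hD
  have hDm : MeasurableSet D :=
    (measurable_fst hDfm).inter ((measurable_snd hDgm).inter
      ((measurable_fst.sub measurable_snd) hDhm))
  set G : ℝ × ℝ → ℝ≥0∞ := fun p => f p.1 ^ a * g p.2 ^ a * h (p.1 - p.2) ^ q with hG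
  have hGm : Measurable G := by fun_prop
  rw [← lintegral_prod G hGm.aemeasurable]
  have hGD : ∀ᵐ p ∂(volume.prod volume : Measure (ℝ × ℝ)), p ∉ D → G p = 0 := by
    filter_upwards [Measure.quasiMeasurePreserving_fst.ae hDf,
      Measure.quasiMeasurePreserving_snd.ae hDg,
      (quasiMeasurePreserving_sub volume volume).ae hDh] with p h1 h2 h3 hp
    by_cases hp1 : p.1 ∈ Df
    · by_cases hp2 : p.2 ∈ Dg
      · have hp3 : p.1 - p.2 ∉ Dh := fun h' => hp ⟨hp1, hp2, h'⟩
        simp [hG, h3 hp3, hq0]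
      · simp [hG, h2 hp2, ha0]
    · simp [hG, h1 hp1, ha0]
  -- The two coordinates are the Gaussian arguments on the right of `gaussDensity_mul_le`;
  -- integrating over the image of this map leaves at most the total Gaussian mass 1.
  set Φ : ℝ × ℝ → ℝ × ℝ := fun p =>
    (c₁ * (T p.1 + U p.2), c₂ * (T p.1 - U p.2 + b * W (p.1 - p.2))) with hΦ
  set Φ' : ℝ × ℝ → (ℝ × ℝ →L[ℝ] ℝ × ℝ) := fun p =>
    LinearMap.toContinuousLinearMap (Matrix.toLin (Module.Basis.finTwoProd ℝ)
      (Module.Basis.finTwoProd ℝ) !![c₁ * deriv T p.1, c₁ * deriv U p.2;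
        c₂ * (deriv T p.1 + b * deriv W (p.1 - p.2)),
        c₂ * (-deriv U p.2 - b * deriv W (p.1 - p.2))]) with hΦ'
  have hdet : ∀ p, (Φ' p).det = -(c₁ * c₂ * (2 * deriv T p.1 * deriv U p.2 +
      b * deriv W (p.1 - p.2) * (deriv T p.1 + deriv U p.2))) := fun p => by
    rw [hΦ', ContinuousLinearMap.det, LinearMap.coe_toContinuousLinearMap, LinearMap.det_toLin,
      Matrix.det_fin_two_of]
    ring
  have hderiv : ∀ p ∈ D, HasFDerivWithinAt Φ (Φ' p) D p := fun p hp => by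
    have dT := (hT _ hp.1).2.1.hasDerivAt.comp_hasFDerivAt p (hasFDerivAt_fst (𝕜 := ℝ))
    have dU := (hU _ hp.2.1).2.1.hasDerivAt.comp_hasFDerivAt p (hasFDerivAt_snd (𝕜 := ℝ))
    have dW := (hW _ hp.2.2).2.1.hasDerivAt.comp_hasFDerivAt p
      ((hasFDerivAt_fst (𝕜 := ℝ) (p := p)).sub (hasFDerivAt_snd (𝕜 := ℝ)))
    have d := ((dT.add dU).const_mul c₁).prodMk (((dT.sub dU).add (dW.const_mul b)).const_mul c₂)
    refine HasFDerivAt.hasFDerivWithinAt (d.congr_fderiv ?_)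
    rw [hΦ']
    beta_reduce
    rw [Matrix.toLin_finTwoProd_toContinuousLinearMap]
    refine ContinuousLinearMap.ext fun v => ?_
    simp only [ContinuousLinearMap.prod_apply, add_apply,
      sub_apply, smul_apply, smul_eq_mul,
      ContinuousLinearMap.coe_fst', ContinuousLinearMap.coe_snd', Prod.mk.injEq]
    constructor <;> ring
  -- If `p.1` increases and the first coordinate is fixed, `T` increases, so `U` and hence `p.2`
  -- decrease. Then `p.1 - p.2` and `W` increase, and all three terms of the second coordinate grow
  -- strictly.
  have hinj : InjOn Φ D := by
    have aux : ∀ p ∈ D, ∀ p' ∈ D, p.1 < p'.1 → Φ p ≠ Φ p' := by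
      intro p hp p' hp' hlt he
      have h1 := mul_left_cancel₀ hc₁0.ne' (congrArg Prod.fst he)
      have h2 := mul_left_cancel₀ hc₂0.ne' (congrArg Prod.snd he)
      have hTT := hTm hp.1 hp'.1 hlt
      have hy : p'.2 < p.2 := (hUm.lt_iff_lt hp'.2.1 hp.2.1).1 (by linarith)
      have hWW := hWm hp.2.2 hp'.2.2 (by linarith)
      have := mul_lt_mul_of_pos_left hWW hb0
      linarith
    intro p hp p' hp' he
    rcases lt_trichotomy p.1 p'.1 with hlt | heq | hlt
    · exact absurd he (aux p hp p' hp' hlt)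
    · have h1 := mul_left_cancel₀ hc₁0.ne' (congrArg Prod.fst he)
      rw [heq] at h1
      exact Prod.ext heq (hUm.injOn hp.2.1 hp'.2.1 (by linarith))
    · exact absurd he.symm (aux p' hp' p hp hlt)
  have hpt : ∀ p ∈ D, G p ≤ ENNReal.ofReal K * (ENNReal.ofReal |(Φ' p).det| *
      (ENNReal.ofReal (gaussDensity (Φ p).1) * ENNReal.ofReal (gaussDensity (Φ p).2))) := by
    intro p hp
    obtain ⟨hT0, -, hTe⟩ := hT _ hp.1
    obtain ⟨hU0, -, hUe⟩ := hU _ hp.2.1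
    obtain ⟨hW0, -, hWe⟩ := hW _ hp.2.2
    have gT := gaussDensity_pos (T p.1)
    have gU := gaussDensity_pos (U p.2)
    have gW := gaussDensity_pos (W (p.1 - p.2))
    have e : G p = ENNReal.ofReal ((deriv T p.1 * gaussDensity (T p.1)) ^ a *
        (deriv U p.2 * gaussDensity (U p.2)) ^ a *
        (deriv W (p.1 - p.2) * gaussDensity (W (p.1 - p.2))) ^ q) := by
      rw [ENNReal.ofReal_mul (by positivity), ENNReal.ofReal_mul (by positivity),
        ← ENNReal.ofReal_rpow_of_nonneg (by positivity) ha0.le,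
        ← ENNReal.ofReal_rpow_of_nonneg (by positivity) ha0.le,
        ← ENNReal.ofReal_rpow_of_nonneg (by positivity) hq0.le, ← hTe, ← hUe, ← hWe]
    rw [e, hdet, abs_neg, abs_of_nonneg (by positivity),
      ← ENNReal.ofReal_mul (gaussDensity_pos _).le, ← ENNReal.ofReal_mul (by positivity),
      ← ENNReal.ofReal_mul hK0]
    refine ENNReal.ofReal_le_ofReal ?_
    rw [Real.mul_rpow hT0.le gT.le, Real.mul_rpow hU0.le gU.le, Real.mul_rpow hW0.le gW.le]
    have h1 := jacobian_lower_bound hw0 hw1 hT0 hU0 hW0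
    have h2 := gaussDensity_mul_le hw0 hw1 (T p.1) (U p.2) (W (p.1 - p.2))
    have h3 := mul_le_mul h1 h2 (by positivity) (by positivity)
    calc _ = _ := by ring
      _ ≤ _ := h3
      _ = _ := by ring
  calc ∫⁻ p, G p ∂(volume.prod volume) = ∫⁻ p in D, G p ∂(volume.prod volume) := by
        rw [← lintegral_indicator hDm]
        refine lintegral_congr_ae ?_
        filter_upwards [hGD] with p hp
        by_cases h : p ∈ D
        · simp [h]
        · simp [h, hp h]
    _ ≤ ∫⁻ p in D, ENNReal.ofReal K * (ENNReal.ofReal |(Φ' p).det| *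
          (ENNReal.ofReal (gaussDensity (Φ p).1) * ENNReal.ofReal (gaussDensity (Φ p).2)))
          ∂(volume.prod volume) := setLIntegral_mono' hDm hpt
    _ = ENNReal.ofReal K * ∫⁻ z in Φ '' D, ENNReal.ofReal (gaussDensity z.1) *
          ENNReal.ofReal (gaussDensity z.2) ∂(volume.prod volume) := by
        rw [lintegral_const_mul' _ _ ENNReal.ofReal_ne_top]
        congr 1
        exact (lintegral_image_eq_lintegral_abs_det_fderiv_mul (volume : Measure (ℝ × ℝ)) hDm hderiv
          hinj fun z => ENNReal.ofReal (gaussDensity z.1) * ENNReal.ofReal (gaussDensity z.2)).symm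
    _ ≤ ENNReal.ofReal K * ∫⁻ z, ENNReal.ofReal (gaussDensity z.1) *
          ENNReal.ofReal (gaussDensity z.2) ∂(volume.prod volume) := by
        gcongr
        exact Measure.restrict_le_self
    _ = ENNReal.ofReal K := by
        have hm : Measurable fun x => ENNReal.ofReal (gaussDensity x) :=
          continuous_gaussDensity.measurable.ennreal_ofReal
        rw [lintegral_prod_mul hm.aemeasurable hm.aemeasurable, lintegral_gaussDensity]
        simp

end YoungOneDim

/-! ### Homogeneity, tensorisation, and the consequence for differences of points of a set. -/

section YoungTensor

open scoped ENNReal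

/-- The sharp Young inequality on `ℝ`. -/
theorem young_lintegral_real {w : ℝ} (hw0 : 0 < w) (hw1 : w < 1) {f g h : ℝ → ℝ≥0∞}
    (hf : Measurable f) (hg : Measurable g) (hh : Measurable h) :
    ∫⁻ x, ∫⁻ y, f x ^ (1 / (2 - w)) * g y ^ (1 / (2 - w)) *
        h (x - y) ^ (2 * ((1 - w) / (2 - w))) ≤
      ENNReal.ofReal (√(w * (2 - w)) / √(2 * w) ^ (2 * ((1 - w) / (2 - w)))) *
        ((∫⁻ x, f x) ^ (1 / (2 - w)) * (∫⁻ x, g x) ^ (1 / (2 - w)) *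
          (∫⁻ x, h x) ^ (2 * ((1 - w) / (2 - w)))) := by
  have h2 : 0 < 2 - w := by linarith
  have h1w : 0 < 1 - w := by linarith
  have hs : 0 < √(2 * w) := Real.sqrt_pos.2 (by linarith)
  have hroot : 0 < √(w * (2 - w)) := Real.sqrt_pos.2 (by positivity)
  have hnorm := fun (f' g' h' : ℝ → ℝ≥0∞) hf' hg' hh' =>
    young_lintegral_of_lintegral_eq_one hw0 hw1 (f := f') (g := g') (h := h') hf' hg' hh'
  have hKpos : 0 < √(w * (2 - w)) / √(2 * w) ^ (2 * ((1 - w) / (2 - w))) := by positivity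
  generalize √(w * (2 - w)) / √(2 * w) ^ (2 * ((1 - w) / (2 - w))) = K at *
  have ha0 : 0 < 1 / (2 - w) := by positivity
  have hq0 : 0 < 2 * ((1 - w) / (2 - w)) := by positivity
  generalize 1 / (2 - w) = a at *
  generalize 2 * ((1 - w) / (2 - w)) = q at *
  -- Integrals equal to 0 or ∞ cannot be normalised. Zeros make the left side vanish; once they are
  -- excluded, an infinite integral makes the right side infinite.
  by_cases hf0 : ∫⁻ x, f x = 0
  · have hz := (lintegral_eq_zero_iff hf).1 hf0
    refine le_of_eq_of_le (lintegral_eq_zero_of_ae_eq_zero ?_) zero_le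
    filter_upwards [hz] with x hx
    simp [hx, ha0]
  by_cases hg0 : ∫⁻ x, g x = 0
  · have hz := (lintegral_eq_zero_iff hg).1 hg0
    refine le_of_eq_of_le (lintegral_eq_zero_of_ae_eq_zero ?_) zero_le
    refine Filter.Eventually.of_forall fun x => lintegral_eq_zero_of_ae_eq_zero ?_
    filter_upwards [hz] with y hy
    simp [hy, ha0]
  by_cases hh0 : ∫⁻ x, h x = 0
  · have hz := (lintegral_eq_zero_iff hh).1 hh0
    refine le_of_eq_of_le (lintegral_eq_zero_of_ae_eq_zero ?_) zero_le
    refine Filter.Eventually.of_forall fun x => lintegral_eq_zero_of_ae_eq_zero ?_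
    filter_upwards [(quasiMeasurePreserving_sub_left volume x).ae hz] with y hy
    simp [hy, hq0]
  have hK0 : ENNReal.ofReal K ≠ 0 := by simpa using hKpos
  have hfa : (∫⁻ x, f x) ^ a ≠ 0 := by simp [hf0, ha0, ha0.le]
  have hga : (∫⁻ x, g x) ^ a ≠ 0 := by simp [hg0, ha0, ha0.le]
  have hhq : (∫⁻ x, h x) ^ q ≠ 0 := by simp [hh0, hq0, hq0.le]
  by_cases hft : ∫⁻ x, f x = ∞
  · refine le_of_le_of_eq le_top ?_
    rw [hft, ENNReal.top_rpow_of_pos ha0, ENNReal.top_mul hga, ENNReal.top_mul hhq,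
      ENNReal.mul_top hK0]
  by_cases hgt : ∫⁻ x, g x = ∞
  · refine le_of_le_of_eq le_top ?_
    rw [hgt, ENNReal.top_rpow_of_pos ha0, ENNReal.mul_top hfa, ENNReal.top_mul hhq,
      ENNReal.mul_top hK0]
  by_cases hht : ∫⁻ x, h x = ∞
  · refine le_of_le_of_eq le_top ?_
    rw [hht, ENNReal.top_rpow_of_pos hq0, ENNReal.mul_top (mul_ne_zero hfa hga),
      ENNReal.mul_top hK0]
  have hscale : ∀ φ : ℝ → ℝ≥0∞, Measurable φ → ∫⁻ x, φ x ≠ 0 → ∫⁻ x, φ x ≠ ∞ →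
      ∫⁻ x, (∫⁻ x, φ x)⁻¹ * φ x = 1 := fun φ hφ h0 ht => by
    rw [lintegral_const_mul _ hφ, ENNReal.inv_mul_cancel h0 ht]
  have key := hnorm _ _ _ (hf.const_mul _) (hg.const_mul _) (hh.const_mul _) (hscale f hf hf0 hft)
    (hscale g hg hg0 hgt) (hscale h hh hh0 hht)
  simp only [ENNReal.mul_rpow_of_nonneg _ _ ha0.le, ENNReal.mul_rpow_of_nonneg _ _ hq0.le,
    ENNReal.inv_rpow] at key
  generalize ∫⁻ x, f x = If at *
  generalize ∫⁻ x, g x = Ig at *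
  generalize ∫⁻ x, h x = Ih at *
  have hfat : If ^ a ≠ ∞ := ENNReal.rpow_ne_top_of_nonneg ha0.le hft
  have hgat : Ig ^ a ≠ ∞ := ENNReal.rpow_ne_top_of_nonneg ha0.le hgt
  have hhqt : Ih ^ q ≠ ∞ := ENNReal.rpow_ne_top_of_nonneg hq0.le hht
  generalize If ^ a = A at *
  generalize Ig ^ a = B at *
  generalize Ih ^ q = C at *
  have hA : A⁻¹ * A = 1 := ENNReal.inv_mul_cancel hfa hfat
  have hB : B⁻¹ * B = 1 := ENNReal.inv_mul_cancel hga hgat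
  have hC : C⁻¹ * C = 1 := ENNReal.inv_mul_cancel hhq hhqt
  have hABC : A⁻¹ * B⁻¹ * C⁻¹ ≠ ∞ := by
    simp [ENNReal.mul_eq_top, hfa, hga, hhq]
  calc ∫⁻ x, ∫⁻ y, f x ^ a * g y ^ a * h (x - y) ^ q
      = (A * B * C) * ∫⁻ x, ∫⁻ y, A⁻¹ * f x ^ a * (B⁻¹ * g y ^ a) * (C⁻¹ * h (x - y) ^ q) := by
        have e : ∀ x y, A⁻¹ * f x ^ a * (B⁻¹ * g y ^ a) * (C⁻¹ * h (x - y) ^ q) =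
            (A⁻¹ * B⁻¹ * C⁻¹) * (f x ^ a * g y ^ a * h (x - y) ^ q) := fun x y => by ring
        simp_rw [e, lintegral_const_mul' _ _ hABC]
        rw [← mul_assoc]
        have : A * B * C * (A⁻¹ * B⁻¹ * C⁻¹) = (A⁻¹ * A) * (B⁻¹ * B) * (C⁻¹ * C) := by ring
        rw [this, hA, hB, hC]
        simp
    _ ≤ (A * B * C) * ENNReal.ofReal K := by gcongr
    _ = _ := mul_comm _ _

theorem lintegral_fin_succ {n : ℕ} {F : (Fin (n + 1) → ℝ) → ℝ≥0∞} (hF : Measurable F) :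
    ∫⁻ x, F x = ∫⁻ s : ℝ, ∫⁻ x : Fin n → ℝ, F (Fin.cons s x) := by
  have hmp := (volume_preserving_piFinSuccAbove (fun _ : Fin (n + 1) => ℝ) 0).symm
  rw [← hmp.lintegral_comp hF]
  have hm : Measurable fun p : ℝ × (Fin n → ℝ) =>
      F ((MeasurableEquiv.piFinSuccAbove (fun _ : Fin (n + 1) => ℝ) 0).symm p) :=
    hF.comp (MeasurableEquiv.measurable _)
  rw [Measure.volume_eq_prod, lintegral_prod _ hm.aemeasurable]
  simp [MeasurableEquiv.piFinSuccAbove, Fin.insertNthEquiv]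

theorem measurable_fin_cons {n : ℕ} :
    Measurable fun p : ℝ × (Fin n → ℝ) => (Fin.cons p.1 p.2 : Fin (n + 1) → ℝ) := by
  refine measurable_pi_iff.2 fun i => ?_
  refine Fin.cases ?_ (fun j => ?_) i
  · simpa using measurable_fst
  · simpa [Function.comp_def] using (measurable_pi_apply j).comp measurable_snd

theorem Measurable.fin_cons {α : Type*} [MeasurableSpace α] {n : ℕ} {u : α → ℝ}
    {v : α → Fin n → ℝ} (hu : Measurable u) (hv : Measurable v) :
    Measurable fun p => (Fin.cons (u p) (v p) : Fin (n + 1) → ℝ) :=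
  measurable_fin_cons.comp (hu.prodMk hv)

theorem fin_cons_sub_fin_cons {n : ℕ} (s t : ℝ) (x y : Fin n → ℝ) :
    (Fin.cons s x : Fin (n + 1) → ℝ) - Fin.cons t y = Fin.cons (s - t) (x - y) := by
  ext i
  refine Fin.cases ?_ (fun j => ?_) i <;> simp

/-- The sharp Young inequality on `ℝⁿ`. -/
theorem young_lintegral_pi {w : ℝ} (hw0 : 0 < w) (hw1 : w < 1) {n : ℕ} :
    ∀ {f g h : (Fin n → ℝ) → ℝ≥0∞}, Measurable f → Measurable g → Measurable h →
    ∫⁻ x, ∫⁻ y, f x ^ (1 / (2 - w)) * g y ^ (1 / (2 - w)) *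
        h (x - y) ^ (2 * ((1 - w) / (2 - w))) ≤
      ENNReal.ofReal (√(w * (2 - w)) / √(2 * w) ^ (2 * ((1 - w) / (2 - w)))) ^ n *
        ((∫⁻ x, f x) ^ (1 / (2 - w)) * (∫⁻ x, g x) ^ (1 / (2 - w)) *
          (∫⁻ x, h x) ^ (2 * ((1 - w) / (2 - w)))) := by
  have hone := fun (f' g' h' : ℝ → ℝ≥0∞) hf' hg' hh' =>
    young_lintegral_real hw0 hw1 (f := f') (g := g') (h := h') hf' hg' hh'
  generalize √(w * (2 - w)) / √(2 * w) ^ (2 * ((1 - w) / (2 - w))) = K at *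
  generalize 1 / (2 - w) = a at *
  generalize 2 * ((1 - w) / (2 - w)) = q at *
  induction n with
  | zero =>
    intro f g h hf hg hh
    simp only [Measure.volume_pi_eq_dirac (ι := Fin 0) 0, lintegral_dirac]
    simp
  | succ n ih =>
    intro f g h hf hg hh
    have hcons : ∀ φ : (Fin (n + 1) → ℝ) → ℝ≥0∞, Measurable φ →
        Measurable fun s : ℝ => ∫⁻ x : Fin n → ℝ, φ (Fin.cons s x) := fun φ hφ =>
      Measurable.lintegral_prod_right' (f := fun p : ℝ × (Fin n → ℝ) => φ (Fin.cons p.1 p.2))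
        (hφ.comp measurable_fin_cons)
    have hslice : ∀ (φ : (Fin (n + 1) → ℝ) → ℝ≥0∞) (s : ℝ), Measurable φ →
        Measurable fun x : Fin n → ℝ => φ (Fin.cons s x) := fun φ s hφ =>
      hφ.comp (measurable_const.fin_cons measurable_id)
    have hm2 : Measurable fun p : (Fin (n + 1) → ℝ) × (Fin (n + 1) → ℝ) =>
        f p.1 ^ a * g p.2 ^ a * h (p.1 - p.2) ^ q := by fun_prop
    calc ∫⁻ x, ∫⁻ y, f x ^ a * g y ^ a * h (x - y) ^ q
        = ∫⁻ s : ℝ, ∫⁻ x : Fin n → ℝ, ∫⁻ t : ℝ, ∫⁻ y : Fin n → ℝ,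
            f (Fin.cons s x) ^ a * g (Fin.cons t y) ^ a *
              h (Fin.cons (s - t) (x - y)) ^ q := by
          rw [lintegral_fin_succ hm2.lintegral_prod_right']
          refine lintegral_congr fun s => lintegral_congr fun x => ?_
          refine (lintegral_fin_succ (hm2.comp measurable_prodMk_left)).trans ?_
          simp only [Function.comp_apply, fin_cons_sub_fin_cons]
      -- Bringing `s` and `t` outside lets the induction hypothesis act on the slices; the slice
      -- integrals are then the functions for the one-dimensional inequality.
      _ = ∫⁻ s : ℝ, ∫⁻ t : ℝ, ∫⁻ x : Fin n → ℝ, ∫⁻ y : Fin n → ℝ,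
            f (Fin.cons s x) ^ a * g (Fin.cons t y) ^ a *
              h (Fin.cons (s - t) (x - y)) ^ q := by
          refine lintegral_congr fun s => lintegral_lintegral_swap ?_
          refine Measurable.aemeasurable ?_
          refine Measurable.lintegral_prod_right'
            (f := fun p : ((Fin n → ℝ) × ℝ) × (Fin n → ℝ) =>
              f (Fin.cons s p.1.1) ^ a * g (Fin.cons p.1.2 p.2) ^ a *
                h (Fin.cons (s - p.1.2) (p.1.1 - p.2)) ^ q) ?_
          refine Measurable.mul (Measurable.mul ?_ ?_) ?_
          · exact (hf.comp (Measurable.fin_cons (by fun_prop) (by fun_prop))).pow_const _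
          · exact (hg.comp (Measurable.fin_cons (by fun_prop) (by fun_prop))).pow_const _
          · exact (hh.comp (Measurable.fin_cons (by fun_prop) (by fun_prop))).pow_const _
      _ ≤ ∫⁻ s : ℝ, ∫⁻ t : ℝ, ENNReal.ofReal K ^ n *
            ((∫⁻ x : Fin n → ℝ, f (Fin.cons s x)) ^ a *
              (∫⁻ x : Fin n → ℝ, g (Fin.cons t x)) ^ a *
              (∫⁻ x : Fin n → ℝ, h (Fin.cons (s - t) x)) ^ q) :=
          lintegral_mono fun s => lintegral_mono fun t =>
            ih (hslice f s hf) (hslice g t hg) (hslice h (s - t) hh)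
      _ = ENNReal.ofReal K ^ n * ∫⁻ s : ℝ, ∫⁻ t : ℝ,
            (∫⁻ x : Fin n → ℝ, f (Fin.cons s x)) ^ a *
              (∫⁻ x : Fin n → ℝ, g (Fin.cons t x)) ^ a *
              (∫⁻ x : Fin n → ℝ, h (Fin.cons (s - t) x)) ^ q := by
          simp_rw [lintegral_const_mul' _ _ (ENNReal.pow_ne_top ENNReal.ofReal_ne_top)]
      _ ≤ ENNReal.ofReal K ^ n * (ENNReal.ofReal K * ((∫⁻ x, f x) ^ a * (∫⁻ x, g x) ^ a *
            (∫⁻ x, h x) ^ q)) := by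
          rw [lintegral_fin_succ hf, lintegral_fin_succ hg, lintegral_fin_succ hh]
          gcongr
          exact hone _ _ _ (hcons f hf) (hcons g hg) (hcons h hh)
      _ = _ := by rw [pow_succ, mul_assoc (ENNReal.ofReal K ^ n)]

/-- The proportion of pairs of points of a set whose difference lies in `√(2 w)` times the set. -/
theorem volume_sub_mem_smul_le {w : ℝ} (hw0 : 0 < w) (hw1 : w < 1) {n : ℕ}
    {K : Set (EuclideanSpace ℝ (Fin n))} (hK : MeasurableSet K) :
    ∫⁻ x, ∫⁻ y, K.indicator 1 x * K.indicator 1 y * (√(2 * w) • K).indicator 1 (x - y) ≤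
      ENNReal.ofReal √(w * (2 - w)) ^ n * (volume K) ^ 2 := by
  have h2 : 0 < 2 - w := by linarith
  have h1w : 0 < 1 - w := by linarith
  have hs : 0 < √(2 * w) := Real.sqrt_pos.2 (by linarith)
  have ha0 : 0 < 1 / (2 - w) := by positivity
  have hq0 : 0 < 2 * ((1 - w) / (2 - w)) := by positivity
  have hsum : 1 / (2 - w) + 1 / (2 - w) + 2 * ((1 - w) / (2 - w)) = 2 := by field_simp; ring
  set tK := √(2 * w) • K with htK
  have htKm : MeasurableSet tK := hK.const_smul₀ _
  have hvol : volume tK = ENNReal.ofReal (√(2 * w) ^ n) * volume K := by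
    rw [htK, Measure.addHaar_smul_of_nonneg _ hs.le]
    simp
  let e := (PiLp.volume_preserving_toLp (Fin n))
  have hme : Measurable (WithLp.toLp 2 : (Fin n → ℝ) → EuclideanSpace ℝ (Fin n)) := e.measurable
  have hind : ∀ {A : Set (EuclideanSpace ℝ (Fin n))}, MeasurableSet A →
      Measurable fun x : Fin n → ℝ => A.indicator (1 : EuclideanSpace ℝ (Fin n) → ℝ≥0∞) (WithLp.toLp 2 x) :=
    fun hA => (measurable_one.indicator hA).comp hme
  have hint : ∀ {A : Set (EuclideanSpace ℝ (Fin n))}, MeasurableSet A →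
      ∫⁻ x : Fin n → ℝ, A.indicator (1 : EuclideanSpace ℝ (Fin n) → ℝ≥0∞) (WithLp.toLp 2 x) = volume A := fun hA => by
    rw [e.lintegral_comp (measurable_one.indicator hA), lintegral_indicator_one hA]
  have hpow : ∀ (A : Set (EuclideanSpace ℝ (Fin n))) (z) {p : ℝ}, 0 < p →
      A.indicator (1 : EuclideanSpace ℝ (Fin n) → ℝ≥0∞) z ^ p = A.indicator 1 z := fun A z p hp => by
    by_cases hz : z ∈ A <;> simp [hz, hp]
  have key := young_lintegral_pi hw0 hw1 (hind hK) (hind hK) (hind htKm)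
  rw [hint hK, hint htKm] at key
  simp only [hpow _ _ ha0, hpow _ _ hq0] at key
  have hm2 : Measurable fun p : EuclideanSpace ℝ (Fin n) × EuclideanSpace ℝ (Fin n) =>
      K.indicator (1 : EuclideanSpace ℝ (Fin n) → ℝ≥0∞) p.1 * K.indicator 1 p.2 * tK.indicator 1 (p.1 - p.2) := by
    have h1 : Measurable (K.indicator (1 : EuclideanSpace ℝ (Fin n) → ℝ≥0∞)) := measurable_one.indicator hK
    have h2 : Measurable (tK.indicator (1 : EuclideanSpace ℝ (Fin n) → ℝ≥0∞)) := measurable_one.indicator htKm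
    fun_prop
  calc _ = ∫⁻ x : Fin n → ℝ, ∫⁻ y : Fin n → ℝ, K.indicator 1 (WithLp.toLp 2 x) *
          K.indicator 1 (WithLp.toLp 2 y) * tK.indicator 1 (WithLp.toLp 2 (x - y)) := by
        rw [← e.lintegral_comp hm2.lintegral_prod_right']
        refine lintegral_congr fun x => ?_
        exact (e.lintegral_comp (hm2.comp measurable_prodMk_left)).symm
    _ ≤ _ := key
    _ = _ := by
        rw [hvol, ENNReal.mul_rpow_of_nonneg _ _ hq0.le,
          ENNReal.ofReal_rpow_of_nonneg (by positivity) hq0.le, ← ENNReal.ofReal_pow (by positivity),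
          ← ENNReal.ofReal_pow (by positivity)]
        -- The volume factor of the dilated set, raised to the third exponent, is exactly the
        -- denominator of Young's constant, and the two cancel.
        have hr : (√(2 * w) ^ n) ^ (2 * ((1 - w) / (2 - w))) =
            (√(2 * w) ^ (2 * ((1 - w) / (2 - w)))) ^ n := by
          rw [← Real.rpow_natCast, ← Real.rpow_natCast, ← Real.rpow_mul hs.le,
            ← Real.rpow_mul hs.le, mul_comm (n : ℝ)]
        have hv : (volume K) ^ 2 = volume K ^ (1 / (2 - w)) * volume K ^ (1 / (2 - w)) *
            volume K ^ (2 * ((1 - w) / (2 - w))) := by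
          rw [← ENNReal.rpow_add_of_nonneg _ _ ha0.le ha0.le,
            ← ENNReal.rpow_add_of_nonneg _ _ (by positivity) hq0.le, hsum, ENNReal.rpow_ofNat]
        rw [hr, hv, div_pow, ENNReal.ofReal_div_of_pos (by positivity)]
        have hc : ENNReal.ofReal ((√(2 * w) ^ (2 * ((1 - w) / (2 - w)))) ^ n) ≠ 0 := by
          have : 0 < (√(2 * w) ^ (2 * ((1 - w) / (2 - w)))) ^ n := by positivity
          simpa using this
        have hct : ENNReal.ofReal ((√(2 * w) ^ (2 * ((1 - w) / (2 - w)))) ^ n) ≠ ∞ :=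
          ENNReal.ofReal_ne_top
        generalize ENNReal.ofReal ((√(2 * w) ^ (2 * ((1 - w) / (2 - w)))) ^ n) = c at *
        rw [div_eq_mul_inv, mul_assoc, ← mul_assoc c⁻¹, mul_comm c⁻¹, mul_assoc _ c⁻¹,
          ← mul_assoc c⁻¹, ENNReal.inv_mul_cancel hc hct, one_mul]

end YoungTensor

/-! ### One-dimensional Brunn-Minkowski and the Prékopa-Leindler inequality. -/

section PrekopaLeindler

open scoped ENNReal

/-- The translates `A + {min B}` and `{max A} + B` lie in `A + B` and can meet only at max A + min
B, a null set. -/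
theorem volume_add_le_of_isCompact {A B : Set ℝ} (hA : IsCompact A) (hB : IsCompact B)
    (hAn : A.Nonempty) (hBn : B.Nonempty) : volume A + volume B ≤ volume (A + B) := by
  obtain ⟨a, ha, hamax⟩ := hA.exists_isGreatest hAn
  obtain ⟨b, hb, hbmin⟩ := hB.exists_isLeast hBn
  have hd : AEDisjoint volume (A + {b}) ({a} + B) := by
    refine measure_mono_null ?_ (Real.volume_singleton (a := a + b))
    rintro _ ⟨⟨x, hx, _, rfl, rfl⟩, ⟨_, rfl, y, hy, he⟩⟩
    have h1 := hamax hx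
    have h2 := hbmin hy
    simp only at he ⊢
    rw [mem_singleton_iff]
    linarith
  have hm : MeasurableSet ({a} + B) := (isCompact_singleton.add hB).measurableSet
  calc volume A + volume B = volume (A + {b}) + volume ({a} + B) := by
        simp [measure_preimage_add_right]
    _ = volume (A + {b} ∪ ({a} + B)) := (measure_union₀ hm.nullMeasurableSet hd).symm
    _ ≤ volume (A + B) := measure_mono (union_subset
        (add_subset_add_left (singleton_subset_iff.2 hb))
        (add_subset_add_right (singleton_subset_iff.2 ha)))

/-- The Brunn-Minkowski inequality on `ℝ`. -/
theorem volume_add_le_of_measurableSet {A B C : Set ℝ} (hA : MeasurableSet A)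
    (hB : MeasurableSet B) (hAn : A.Nonempty) (hBn : B.Nonempty) (hC : A + B ⊆ C) :
    volume A + volume B ≤ volume C := by
  obtain ⟨a, ha⟩ := hAn
  obtain ⟨b, hb⟩ := hBn
  have key : ∀ K, K ⊆ A → IsCompact K → ∀ L, L ⊆ B → IsCompact L →
      volume K + volume L ≤ volume C := by
    intro K hKA hK L hLB hL
    -- The approximating compact sets may be empty; adding a point of `A` and of `B` keeps the
    -- sumset inequality applicable.
    calc volume K + volume L ≤ volume (insert a K) + volume (insert b L) := by
          gcongr <;> exact subset_insert _ _
      _ ≤ volume (insert a K + insert b L) := volume_add_le_of_isCompact (hK.insert a)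
          (hL.insert b) (insert_nonempty _ _) (insert_nonempty _ _)
      _ ≤ volume C := measure_mono ((add_subset_add (insert_subset ha hKA)
          (insert_subset hb hLB)).trans hC)
  have e : ∀ {S : Set ℝ}, MeasurableSet S → volume S =
      ⨆ (K : Set ℝ) (_ : K ⊆ S ∧ IsCompact K), volume K := fun hS => by
    rw [hS.measure_eq_iSup_isCompact]
    simp_rw [iSup_and]
  rw [e hA, e hB]
  exact ENNReal.biSup_add_biSup_le' ⟨∅, empty_subset _, isCompact_empty⟩
    ⟨∅, empty_subset _, isCompact_empty⟩ fun K hK L hL => key K hK.1 hK.2 L hL.1 hL.2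

theorem ennreal_geom_mean_le_arith_mean {l : ℝ} (hl0 : 0 < l) (hl1 : l < 1) (x y : ℝ≥0∞) :
    x ^ l * y ^ (1 - l) ≤ ENNReal.ofReal l * x + ENNReal.ofReal (1 - l) * y := by
  have h1l : 0 < 1 - l := by linarith
  by_cases hx : x = ∞
  · refine le_of_le_of_eq le_top ?_
    rw [hx, ENNReal.mul_top (by simpa using hl0), top_add]
  by_cases hy : y = ∞
  · refine le_of_le_of_eq le_top ?_
    rw [hy, ENNReal.mul_top (by simpa using h1l), add_top]
  rw [← ENNReal.ofReal_toReal hx, ← ENNReal.ofReal_toReal hy,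
    ENNReal.ofReal_rpow_of_nonneg ENNReal.toReal_nonneg hl0.le,
    ENNReal.ofReal_rpow_of_nonneg ENNReal.toReal_nonneg h1l.le,
    ← ENNReal.ofReal_mul (by positivity), ← ENNReal.ofReal_mul hl0.le,
    ← ENNReal.ofReal_mul h1l.le, ← ENNReal.ofReal_add (by positivity) (by positivity)]
  exact ENNReal.ofReal_le_ofReal (Real.geom_mean_le_arith_mean2_weighted hl0.le h1l.le
    ENNReal.toReal_nonneg ENNReal.toReal_nonneg (by ring))

theorem lintegral_eq_lintegral_meas_ofReal_lt {f : ℝ → ℝ≥0∞} (hf : Measurable f)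
    (hfin : ∀ x, f x ≠ ∞) :
    ∫⁻ x, f x = ∫⁻ t in Ioi (0 : ℝ), volume {x | ENNReal.ofReal t < f x} := by
  have h := lintegral_eq_lintegral_meas_lt (volume : Measure ℝ) (f := fun x => (f x).toReal)
    (Filter.Eventually.of_forall fun _ => ENNReal.toReal_nonneg) hf.ennreal_toReal.aemeasurable
  simp only [ENNReal.ofReal_toReal (hfin _)] at h
  rw [h]
  refine setLIntegral_congr_fun measurableSet_Ioi fun t ht => ?_
  simp only [ENNReal.ofReal_lt_iff_lt_toReal (le_of_lt ht) (hfin _)]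

/-- The linearised Prékopa-Leindler inequality on `ℝ` for functions with supremum one. -/
theorem lintegral_add_le_of_iSup_eq_one {l : ℝ} (hl0 : 0 < l) (hl1 : l < 1) {f g h : ℝ → ℝ≥0∞}
    (hf : Measurable f) (hg : Measurable g) (hh : Measurable h) (hf1 : ⨆ x, f x = 1)
    (hg1 : ⨆ x, g x = 1) (hfgh : ∀ x y, f x ^ l * g y ^ (1 - l) ≤ h (l * x + (1 - l) * y)) :
    ENNReal.ofReal l * (∫⁻ x, f x) + ENNReal.ofReal (1 - l) * (∫⁻ x, g x) ≤ ∫⁻ x, h x := by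
  have h1l : 0 < 1 - l := by linarith
  have hfle : ∀ x, f x ≤ 1 := fun x => hf1 ▸ le_iSup f x
  have hgle : ∀ x, g x ≤ 1 := fun x => hg1 ▸ le_iSup g x
  have hfin : ∀ {φ : ℝ → ℝ≥0∞}, (∀ x, φ x ≤ 1) → ∀ x, φ x ≠ ∞ := fun hφ x =>
    ((hφ x).trans_lt ENNReal.one_lt_top).ne
  -- Truncation makes the third function finite, as the layer-cake formula requires; only levels
  -- below 1 matter.
  refine le_trans ?_ (lintegral_mono (f := fun x => min (h x) 1) fun x => min_le_left _ _)
  have hm : Measurable fun x => min (h x) 1 := hh.min measurable_const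
  rw [lintegral_eq_lintegral_meas_ofReal_lt hf (hfin hfle),
    lintegral_eq_lintegral_meas_ofReal_lt hg (hfin hgle),
    lintegral_eq_lintegral_meas_ofReal_lt hm (hfin fun x => min_le_right _ _),
    ← lintegral_const_mul' _ _ ENNReal.ofReal_ne_top,
    ← lintegral_const_mul' _ _ ENNReal.ofReal_ne_top, ← lintegral_add_left]
  swap
  · refine Measurable.const_mul ?_ _
    refine Antitone.measurable fun s t hst => measure_mono fun x hx => ?_
    exact (ENNReal.ofReal_le_ofReal hst).trans_lt hx
  refine setLIntegral_mono' measurableSet_Ioi fun t ht => ?_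
  by_cases ht1 : 1 ≤ ENNReal.ofReal t
  · have e : ∀ {φ : ℝ → ℝ≥0∞}, (∀ x, φ x ≤ 1) → {x | ENNReal.ofReal t < φ x} = ∅ := fun hφ =>
      eq_empty_of_forall_notMem fun x hx => not_lt.2 ((hφ x).trans ht1) hx
    simp [e hfle, e hgle]
  · push Not at ht1
    have scale : ∀ {c : ℝ}, 0 < c → ∀ S : Set ℝ, ENNReal.ofReal c * volume S = volume (c • S) :=
      fun hc S => by rw [Measure.addHaar_smul_of_nonneg _ hc.le]; simp
    rw [scale hl0, scale h1l]
    -- Supremum one makes both level sets nonempty at every level below 1, which Brunn-Minkowski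
    -- needs.
    have hne : ∀ {φ : ℝ → ℝ≥0∞}, ⨆ x, φ x = 1 → {x | ENNReal.ofReal t < φ x}.Nonempty := fun hφ => by
      rw [← hφ] at ht1
      exact lt_iSup_iff.1 ht1
    refine volume_add_le_of_measurableSet
      ((measurableSet_lt measurable_const hf).const_smul₀ _)
      ((measurableSet_lt measurable_const hg).const_smul₀ _) (hne hf1).smul_set
      (hne hg1).smul_set ?_
    rintro _ ⟨_, ⟨x, hx, rfl⟩, _, ⟨y, hy, rfl⟩, rfl⟩
    refine lt_min ?_ ht1
    refine lt_of_lt_of_le ?_ (hfgh x y)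
    have ht0 : ENNReal.ofReal t ≠ 0 := by simpa using ht
    calc ENNReal.ofReal t = ENNReal.ofReal t ^ l * ENNReal.ofReal t ^ (1 - l) := by
          rw [← ENNReal.rpow_add _ _ ht0 ENNReal.ofReal_ne_top]
          simp
      _ < f x ^ l * g y ^ (1 - l) := ENNReal.mul_lt_mul (ENNReal.rpow_lt_rpow hx hl0)
          (ENNReal.rpow_lt_rpow hy h1l)

/-- Rescaling both functions to supremum one gives the additive form, from which AM-GM recovers the
multiplicative one; the scaling factors cancel by homogeneity. -/
theorem prekopa_leindler_real_of_iSup_ne_top {l : ℝ} (hl0 : 0 < l) (hl1 : l < 1)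
    {f g h : ℝ → ℝ≥0∞} (hf : Measurable f) (hg : Measurable g) (hh : Measurable h)
    (hft : ⨆ x, f x ≠ ∞) (hgt : ⨆ x, g x ≠ ∞)
    (hfgh : ∀ x y, f x ^ l * g y ^ (1 - l) ≤ h (l * x + (1 - l) * y)) :
    (∫⁻ x, f x) ^ l * (∫⁻ x, g x) ^ (1 - l) ≤ ∫⁻ x, h x := by
  have h1l : 0 < 1 - l := by linarith
  by_cases hf0 : ⨆ x, f x = 0
  · have : ∀ x, f x = 0 := by simpa using hf0
    simp [this, hl0]
  by_cases hg0 : ⨆ x, g x = 0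
  · have : ∀ x, g x = 0 := by simpa using hg0
    simp [this, hl1]
  set A := ⨆ x, f x with hA
  set B := ⨆ x, g x with hB
  have hAl : A ^ l ≠ 0 := by simp [hf0, hl0, hl0.le]
  have hAlt : A ^ l ≠ ∞ := ENNReal.rpow_ne_top_of_nonneg hl0.le hft
  have hBl : B ^ (1 - l) ≠ 0 := by simp [hg0, hl1, hl1.le]
  have hBlt : B ^ (1 - l) ≠ ∞ := ENNReal.rpow_ne_top_of_nonneg h1l.le hgt
  have key := lintegral_add_le_of_iSup_eq_one hl0 hl1 (hf.const_mul A⁻¹) (hg.const_mul B⁻¹)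
    (hh.const_mul ((A ^ l)⁻¹ * (B ^ (1 - l))⁻¹))
    (by rw [← ENNReal.mul_iSup, ENNReal.inv_mul_cancel hf0 hft])
    (by rw [← ENNReal.mul_iSup, ENNReal.inv_mul_cancel hg0 hgt])
    (fun x y => by
      rw [ENNReal.mul_rpow_of_nonneg _ _ hl0.le, ENNReal.mul_rpow_of_nonneg _ _ h1l.le,
        ENNReal.inv_rpow, ENNReal.inv_rpow, mul_mul_mul_comm]
      gcongr
      exact hfgh x y)
  have hAB : (A ^ l)⁻¹ * (B ^ (1 - l))⁻¹ ≠ ∞ := by simp [ENNReal.mul_eq_top, hAl, hBl]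
  have key2 := (ennreal_geom_mean_le_arith_mean hl0 hl1 _ _).trans key
  rw [lintegral_const_mul _ hf, lintegral_const_mul _ hg, lintegral_const_mul _ hh,
    ENNReal.mul_rpow_of_nonneg _ _ hl0.le, ENNReal.mul_rpow_of_nonneg _ _ h1l.le,
    ENNReal.inv_rpow, ENNReal.inv_rpow, mul_mul_mul_comm] at key2
  have hAB0 : (A ^ l)⁻¹ * (B ^ (1 - l))⁻¹ ≠ 0 := by
    simp [hAlt, hBlt]
  exact (ENNReal.mul_le_mul_iff_right hAB0 hAB).1 key2

/-- The Prékopa-Leindler inequality on `ℝ`. -/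
theorem prekopa_leindler_real {l : ℝ} (hl0 : 0 < l) (hl1 : l < 1)
    {f g h : ℝ → ℝ≥0∞} (hf : Measurable f) (hg : Measurable g) (hh : Measurable h)
    (hfgh : ∀ x y, f x ^ l * g y ^ (1 - l) ≤ h (l * x + (1 - l) * y)) :
    (∫⁻ x, f x) ^ l * (∫⁻ x, g x) ^ (1 - l) ≤ ∫⁻ x, h x := by
  have h1l : 0 < 1 - l := by linarith
  by_cases hf0 : ∫⁻ x, f x = 0
  · simp [hf0, hl0]
  by_cases hg0 : ∫⁻ x, g x = 0
  · simp [hg0, hl1]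
  have trunc : ∀ {φ : ℝ → ℝ≥0∞}, Measurable φ → Filter.Tendsto
      (fun k : ℕ => ∫⁻ x, min (φ x) k) Filter.atTop (𝓝 (∫⁻ x, φ x)) := fun {φ} hφ => by
    refine lintegral_tendsto_of_tendsto_of_monotone
      (fun k => (hφ.min measurable_const).aemeasurable)
      (Filter.Eventually.of_forall fun x i j hij =>
        min_le_min_left _ (Nat.cast_le.2 hij))
      (Filter.Eventually.of_forall fun x => ?_)
    have := (tendsto_const_nhds (x := φ x)).min ENNReal.tendsto_nat_nhds_top
    simpa using this
  have hlim := ENNReal.Tendsto.mul (((ENNReal.continuous_rpow_const (y := l)).tendsto _).comp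
    (trunc hf)) (by left; simp [hf0, hl0, hl0.le])
    (((ENNReal.continuous_rpow_const (y := 1 - l)).tendsto _).comp (trunc hg))
    (by left; simp [hg0, hl1, hl1.le])
  refine le_of_tendsto hlim (Filter.Eventually.of_forall fun k => ?_)
  have hb : ∀ φ : ℝ → ℝ≥0∞, ⨆ x, min (φ x) (k : ℝ≥0∞) ≠ ∞ := fun φ =>
    ((iSup_le fun x => min_le_right _ _).trans_lt (ENNReal.natCast_lt_top k)).ne
  refine prekopa_leindler_real_of_iSup_ne_top hl0 hl1 (hf.min measurable_const)
    (hg.min measurable_const) hh (hb f) (hb g) fun x y => le_trans ?_ (hfgh x y)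
  gcongr <;> exact min_le_left _ _

/-- The Prékopa-Leindler inequality on `ℝⁿ`. -/
theorem prekopa_leindler_pi {l : ℝ} (hl0 : 0 < l) (hl1 : l < 1) {n : ℕ} :
    ∀ {f g h : (Fin n → ℝ) → ℝ≥0∞}, Measurable f → Measurable g → Measurable h →
    (∀ x y, f x ^ l * g y ^ (1 - l) ≤ h (l • x + (1 - l) • y)) →
    (∫⁻ x, f x) ^ l * (∫⁻ x, g x) ^ (1 - l) ≤ ∫⁻ x, h x := by
  induction n with
  | zero =>
    intro f g h hf hg hh hfgh
    simp only [Measure.volume_pi_eq_dirac (ι := Fin 0) 0, lintegral_dirac]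
    exact (hfgh 0 0).trans (by simp)
  | succ n ih =>
    intro f g h hf hg hh hfgh
    have hcons : ∀ φ : (Fin (n + 1) → ℝ) → ℝ≥0∞, Measurable φ →
        Measurable fun s : ℝ => ∫⁻ x : Fin n → ℝ, φ (Fin.cons s x) := fun φ hφ =>
      Measurable.lintegral_prod_right' (f := fun p : ℝ × (Fin n → ℝ) => φ (Fin.cons p.1 p.2))
        (hφ.comp measurable_fin_cons)
    have hslice : ∀ (φ : (Fin (n + 1) → ℝ) → ℝ≥0∞) (s : ℝ), Measurable φ →
        Measurable fun x : Fin n → ℝ => φ (Fin.cons s x) := fun φ s hφ =>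
      hφ.comp (measurable_const.fin_cons measurable_id)
    rw [lintegral_fin_succ hf, lintegral_fin_succ hg, lintegral_fin_succ hh]
    refine prekopa_leindler_real hl0 hl1 (hcons f hf) (hcons g hg) (hcons h hh) fun s t => ?_
    refine ih (hslice f s hf) (hslice g t hg) (hslice h _ hh) fun x y => ?_
    refine (hfgh _ _).trans (le_of_eq (congrArg h ?_))
    ext i
    refine Fin.cases ?_ (fun j => ?_) i <;> simp

theorem prekopa_leindler_euclidean {l : ℝ} (hl0 : 0 < l) (hl1 : l < 1) {n : ℕ}
    {f g h : EuclideanSpace ℝ (Fin n) → ℝ≥0∞} (hf : Measurable f) (hg : Measurable g)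
    (hh : Measurable h) (hfgh : ∀ x y, f x ^ l * g y ^ (1 - l) ≤ h (l • x + (1 - l) • y)) :
    (∫⁻ x, f x) ^ l * (∫⁻ x, g x) ^ (1 - l) ≤ ∫⁻ x, h x := by
  let e := PiLp.volume_preserving_toLp (Fin n)
  rw [← e.lintegral_comp hf, ← e.lintegral_comp hg, ← e.lintegral_comp hh]
  exact prekopa_leindler_pi hl0 hl1 (hf.comp e.measurable) (hg.comp e.measurable)
    (hh.comp e.measurable) fun x y => hfgh _ _

end PrekopaLeindler

/-! ### Symmetric intersections, the law of the midpoint, and concentration of distances. -/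

section SymmetricIntersection

open scoped ENNReal

variable {n : ℕ} {K : Set (EuclideanSpace ℝ (Fin n))}

theorem isCompact_symmInter (hK : IsCompact K) (z : EuclideanSpace ℝ (Fin n)) :
    IsCompact ((K - {z}) ∩ ({z} - K)) := by
  simp only [sub_eq_add_neg]
  exact (hK.add isCompact_singleton.neg).inter (isCompact_singleton.add hK.neg)

/-- The volume of the symmetric intersections of a convex body is log-concave. -/
theorem volume_symmInter_logConcave (hK : IsConvexBody K) {l : ℝ} (hl0 : 0 < l) (hl1 : l < 1)
    (x y : EuclideanSpace ℝ (Fin n)) :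
    volume ((K - {x}) ∩ ({x} - K)) ^ l * volume ((K - {y}) ∩ ({y} - K)) ^ (1 - l) ≤
      volume ((K - {l • x + (1 - l) • y}) ∩ ({l • x + (1 - l) • y} - K)) := by
  have h1l : 0 < 1 - l := by linarith
  have hm := fun z => (isCompact_symmInter hK.isCompact z).measurableSet
  rw [← lintegral_indicator_one (hm x), ← lintegral_indicator_one (hm y),
    ← lintegral_indicator_one (hm _)]
  refine prekopa_leindler_euclidean hl0 hl1 (measurable_one.indicator (hm x))
    (measurable_one.indicator (hm y)) (measurable_one.indicator (hm _)) fun u v => ?_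
  by_cases hu : u ∈ (K - {x}) ∩ ({x} - K)
  swap
  · rw [indicator_of_notMem hu, ENNReal.zero_rpow_of_pos hl0, zero_mul]
    exact zero_le
  by_cases hv : v ∈ (K - {y}) ∩ ({y} - K)
  swap
  · rw [indicator_of_notMem hv, ENNReal.zero_rpow_of_pos h1l, mul_zero]
    exact zero_le
  have huv : l • u + (1 - l) • v ∈
      (K - {l • x + (1 - l) • y}) ∩ ({l • x + (1 - l) • y} - K) := by
    rw [mem_symmInter] at hu hv ⊢
    constructor
    · convert hK.convex hu.1 hv.1 hl0.le h1l.le (by ring) using 1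
      module
    · convert hK.convex hu.2 hv.2 hl0.le h1l.le (by ring) using 1
      module
  rw [indicator_of_mem huv]
  refine mul_le_one' ?_ ?_ <;> refine ENNReal.rpow_le_one ?_ (by linarith) <;>
    exact indicator_le_self' (fun _ _ => zero_le) _ |>.trans (by simp)

/-- Translation by `z` exhibits the volume as the self-convolution of the indicator of `K` at 2z. -/
theorem volume_symmInter_eq_lintegral (hK : IsCompact K) (z : EuclideanSpace ℝ (Fin n)) :
    volume ((K - {z}) ∩ ({z} - K)) =
      ∫⁻ x, K.indicator 1 x * K.indicator 1 ((2 : ℝ) • z - x) := by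
  rw [← lintegral_indicator_one (isCompact_symmInter hK z).measurableSet,
    ← lintegral_sub_right_eq_self _ z]
  refine lintegral_congr fun x => ?_
  have hiff : x - z ∈ (K - {z}) ∩ ({z} - K) ↔ x ∈ K ∧ (2 : ℝ) • z - x ∈ K := by
    have : z - (x - z) = (2 : ℝ) • z - x := by module
    rw [mem_symmInter, sub_add_cancel, this]
  by_cases h1 : x ∈ K <;> by_cases h2 : (2 : ℝ) • z - x ∈ K <;>
    simp only [indicator, hiff, h1, h2] <;> simp

theorem lintegral_eq_two_pow_mul_lintegral_comp {F : EuclideanSpace ℝ (Fin n) → ℝ≥0∞}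
    (hF : Measurable F) (x : EuclideanSpace ℝ (Fin n)) :
    ∫⁻ y, F y = 2 ^ n * ∫⁻ z, F ((2 : ℝ) • z - x) := by
  have h := Measure.map_addHaar_smul (volume : Measure (EuclideanSpace ℝ (Fin n)))
    (two_ne_zero : (2 : ℝ) ≠ 0)
  have hm : Measurable fun y => F (y - x) := by fun_prop
  have e : ∫⁻ z, F ((2 : ℝ) • z - x) = (2 ^ n)⁻¹ * ∫⁻ y, F y := by
    rw [← lintegral_map (f := fun y => F (y - x)) hm (measurable_const_smul (2 : ℝ)), h,
      lintegral_smul_measure, lintegral_sub_right_eq_self]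
    simp [abs_of_pos, ENNReal.ofReal_inv_of_pos, ENNReal.ofReal_pow]
  rw [e, ← mul_assoc, ENNReal.mul_inv_cancel (by simp) (by simp), one_mul]

theorem measurable_volume_symmInter (hK : IsCompact K) :
    Measurable fun z => volume ((K - {z}) ∩ ({z} - K)) := by
  simp only [volume_symmInter_eq_lintegral hK]
  have h1 : Measurable (K.indicator (1 : EuclideanSpace ℝ (Fin n) → ℝ≥0∞)) :=
    measurable_one.indicator hK.measurableSet
  refine Measurable.lintegral_prod_right' (f := fun p : EuclideanSpace ℝ (Fin n) ×
    EuclideanSpace ℝ (Fin n) => K.indicator (1 : EuclideanSpace ℝ (Fin n) → ℝ≥0∞) p.2 *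
      K.indicator 1 ((2 : ℝ) • p.1 - p.2)) ?_
  fun_prop

/-- The midpoint of two independent uniform points of `K` has density proportional to the volume
of the symmetric intersections. -/
theorem map_midpoint_prod_restrict (hK : IsCompact K) :
    Measure.map (fun p : EuclideanSpace ℝ (Fin n) × EuclideanSpace ℝ (Fin n) =>
      (1 / 2 : ℝ) • (p.1 + p.2)) ((volume.restrict K).prod (volume.restrict K)) =
      volume.withDensity fun z => 2 ^ n * volume ((K - {z}) ∩ ({z} - K)) := by
  have hKm := hK.measurableSet
  have h1 : Measurable (K.indicator (1 : EuclideanSpace ℝ (Fin n) → ℝ≥0∞)) :=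
    measurable_one.indicator hKm
  refine Measure.ext fun A hA => ?_
  have hA1 : Measurable (A.indicator (1 : EuclideanSpace ℝ (Fin n) → ℝ≥0∞)) :=
    measurable_one.indicator hA
  have hmid : Measurable fun p : EuclideanSpace ℝ (Fin n) × EuclideanSpace ℝ (Fin n) =>
      (1 / 2 : ℝ) • (p.1 + p.2) := by fun_prop
  rw [← lintegral_indicator_one hA, lintegral_map hA1 hmid,
    lintegral_prod (fun p => A.indicator 1 ((1 / 2 : ℝ) • (p.1 + p.2)))
      (hA1.comp hmid).aemeasurable, withDensity_apply _ hA, ← lintegral_indicator hA,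
    ← lintegral_indicator hKm]
  calc ∫⁻ x, K.indicator (fun x => ∫⁻ y in K, A.indicator 1 ((1 / 2 : ℝ) • (x + y))) x
      = ∫⁻ x, ∫⁻ z, 2 ^ n * (K.indicator 1 x * K.indicator 1 ((2 : ℝ) • z - x) *
          A.indicator 1 z) := by
        refine lintegral_congr fun x => ?_
        rw [lintegral_const_mul' _ _ (by simp)]
        by_cases hx : x ∈ K
        · rw [indicator_of_mem hx, ← lintegral_indicator hKm,
            lintegral_eq_two_pow_mul_lintegral_comp (Measurable.indicator (by fun_prop) hKm) x]
          congr 1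
          refine lintegral_congr fun z => ?_
          have : (1 / 2 : ℝ) • (x + ((2 : ℝ) • z - x)) = z := by module
          by_cases hz : (2 : ℝ) • z - x ∈ K
          · rw [indicator_of_mem hz, indicator_of_mem hz, indicator_of_mem hx, this]
            simp
          · simp [indicator_of_notMem hz]
        · simp [indicator_of_notMem hx]
    _ = ∫⁻ z, ∫⁻ x, 2 ^ n * (K.indicator 1 x * K.indicator 1 ((2 : ℝ) • z - x) *
          A.indicator 1 z) := by
        refine lintegral_lintegral_swap (Measurable.aemeasurable ?_)
        simp only [Function.uncurry_def]
        fun_prop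
    _ = _ := by
        refine lintegral_congr fun z => ?_
        rw [lintegral_const_mul' _ _ (by simp)]
        by_cases hz : z ∈ A
        · simp only [indicator_of_mem hz, volume_symmInter_eq_lintegral hK, Pi.one_apply, mul_one]
        · simp [hz]

/-- With w = ε²/2 one has w(2-w) = 1 - (1-w)² and 1 - w = (√2-ε)(√2+ε)/2. Since (√2+ε)² ≥ 2, this is
at most 1 - (√2-ε)²/2, and `1 + t ≤ exp t` finishes after squaring. -/
theorem sqrt_mul_two_sub_le_exp {ε : ℝ} (hε₀ : 0 < ε) (hε₁ : ε < √2) :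
    √(ε ^ 2 / 2 * (2 - ε ^ 2 / 2)) ≤ Real.exp (-((√2 - ε) ^ 2 / 4)) := by
  have h2 : √2 ^ 2 = 2 := Real.sq_sqrt (by norm_num)
  refine Real.sqrt_le_iff.2 ⟨(Real.exp_pos _).le, ?_⟩
  rw [← Real.exp_nat_mul]
  refine le_trans ?_ (Real.add_one_le_exp _)
  push_cast
  have h3 : (√2 - ε) ^ 2 / 2 ≤ (1 - ε ^ 2 / 2) ^ 2 := by
    have e : 1 - ε ^ 2 / 2 = (√2 - ε) * (√2 + ε) / 2 := by linear_combination (-1 / 2) * h2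
    rw [e]
    have h4 : 2 ≤ (√2 + ε) ^ 2 := by nlinarith [Real.sqrt_nonneg 2]
    nlinarith [mul_le_mul_of_nonneg_left h4 (sq_nonneg (√2 - ε))]
  linarith

/-- Concentration of the distance of two independent uniform points of a convex body. -/
theorem prod_restrict_gauge_sub_lt_le (hK : IsConvexBody K) (h0 : K ∈ 𝓝 0) {ε : ℝ} (hε₀ : 0 < ε)
    (hε₁ : ε < √2) :
    ((volume.restrict K).prod (volume.restrict K)) {p | gauge K (p.1 - p.2) < ε} ≤
      ENNReal.ofReal (Real.exp (-((√2 - ε) ^ 2 / 4 * n))) * volume K ^ 2 := by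
  have h2 : √2 ^ 2 = 2 := Real.sq_sqrt (by norm_num)
  have hKm := hK.isCompact.measurableSet
  have hw0 : 0 < ε ^ 2 / 2 := by positivity
  have hw1 : ε ^ 2 / 2 < 1 := by nlinarith [Real.sqrt_nonneg 2]
  have hsq : √(2 * (ε ^ 2 / 2)) = ε := by
    rw [mul_div_cancel₀ _ (two_ne_zero), Real.sqrt_sq hε₀.le]
  have key := volume_sub_mem_smul_le hw0 hw1 hKm
  rw [hsq] at key
  have hεK : MeasurableSet (ε • K) := hKm.const_smul₀ ε
  have h1 : Measurable (K.indicator (1 : EuclideanSpace ℝ (Fin n) → ℝ≥0∞)) :=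
    measurable_one.indicator hKm
  have h2 : Measurable ((ε • K).indicator (1 : EuclideanSpace ℝ (Fin n) → ℝ≥0∞)) :=
    measurable_one.indicator hεK
  set B : Set (EuclideanSpace ℝ (Fin n) × EuclideanSpace ℝ (Fin n)) :=
    {p | p.1 - p.2 ∈ ε • K} ∩ K ×ˢ K with hB
  have hBm : MeasurableSet B :=
    ((measurable_fst.sub measurable_snd) hεK).inter (hKm.prod hKm)
  have hsub : {p : EuclideanSpace ℝ (Fin n) × EuclideanSpace ℝ (Fin n) |
      gauge K (p.1 - p.2) < ε} ∩ K ×ˢ K ⊆ B := by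
    rintro p ⟨hp, hpK⟩
    refine ⟨?_, hpK⟩
    obtain ⟨b, hb0, hbε, x, hx, hxb⟩ := exists_lt_of_gauge_lt (absorbent_nhds_zero h0) hp
    refine ⟨(b / ε) • x, hK.convex.smul_mem_of_zero_mem (mem_of_mem_nhds h0) hx
      ⟨by positivity, (div_le_one hε₀).2 hbε.le⟩, ?_⟩
    simp only [← hxb, smul_smul, mul_div_cancel₀ _ hε₀.ne']
  rw [Measure.prod_restrict, Measure.restrict_apply' (hKm.prod hKm)]
  calc _ ≤ (volume.prod volume) B := measure_mono hsub
    _ = ∫⁻ x, ∫⁻ y, K.indicator 1 x * K.indicator 1 y * (ε • K).indicator 1 (x - y) := by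
        rw [← lintegral_indicator_one hBm,
          lintegral_prod _ (measurable_one.indicator hBm).aemeasurable]
        refine lintegral_congr fun x => lintegral_congr fun y => ?_
        by_cases hx : x ∈ K <;> by_cases hy : y ∈ K <;> by_cases hxy : x - y ∈ ε • K <;>
          simp [indicator, hB, hx, hy, hxy]
    _ ≤ _ := key
    _ ≤ _ := by
        gcongr
        rw [← ENNReal.ofReal_pow (Real.sqrt_nonneg _)]
        refine ENNReal.ofReal_le_ofReal ?_
        calc √(ε ^ 2 / 2 * (2 - ε ^ 2 / 2)) ^ n ≤ Real.exp (-((√2 - ε) ^ 2 / 4)) ^ n :=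
              pow_le_pow_left₀ (Real.sqrt_nonneg _) (sqrt_mul_two_sub_le_exp hε₀ hε₁) n
          _ = _ := by rw [← Real.exp_nat_mul]; congr 1; ring

end SymmetricIntersection

/-! ### The Kövner-Besicovitch bound, and convexity tools for the centered bound. -/

section ConvexBodies

open scoped ENNReal

variable {n : ℕ} {K : Set (EuclideanSpace ℝ (Fin n))}

theorem IsConvexBody.volume_pos (hK : IsConvexBody K) : 0 < volume.real K :=
  ENNReal.toReal_pos (ne_of_gt (Measure.measure_pos_of_nonempty_interior _ hK.interior_nonempty))
    hK.isCompact.measure_lt_top.ne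

theorem IsConvexBody.integrableOn_id (hK : IsConvexBody K) :
    IntegrableOn (fun x : EuclideanSpace ℝ (Fin n) => x) K :=
  continuousOn_id.integrableOn_compact hK.isCompact

/-- The average over a ball inside the interior stays in that ball, and averaging in the rest of a
convex set cannot push it to the boundary. For a centered body this makes `K` a neighbourhood of 0,
hence its gauge continuous. -/
theorem IsConvexBody.barycenter_mem_interior (hK : IsConvexBody K) :
    barycenter K ∈ interior K := by
  have hf : IsFiniteMeasure (volume.restrict K) :=
    isFiniteMeasure_restrict.2 hK.isCompact.measure_lt_top.ne
  obtain ⟨c, hc⟩ := hK.interior_nonempty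
  obtain ⟨ρ, hρ, hsub⟩ := Metric.nhds_basis_closedBall.mem_iff.1
    (isOpen_interior.mem_nhds hc)
  have hball : (volume.restrict K) (Metric.closedBall c ρ) ≠ 0 := by
    rw [Measure.restrict_apply Metric.isClosed_closedBall.measurableSet,
      inter_eq_left.2 (hsub.trans interior_subset)]
    exact (Metric.measure_closedBall_pos _ _ hρ).ne'
  refine hK.convex.average_mem_interior_of_set hball
    (ae_restrict_mem hK.isCompact.measurableSet) hK.integrableOn_id (hsub ?_)
  exact (convex_closedBall c ρ).set_average_mem Metric.isClosed_closedBall hball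
    (measure_ne_top _ _) (ae_restrict_mem Metric.isClosed_closedBall.measurableSet)
    (Integrable.integrableOn hK.integrableOn_id)

theorem IsConvexBody.setIntegral_id_eq_zero (hK : IsConvexBody K) (hc : barycenter K = 0) :
    ∫ x in K, x = 0 := by
  have h : (volume.real K)⁻¹ • ∫ x in K, x = 0 := by rw [← setAverage_eq]; exact hc
  exact (smul_eq_zero.1 h).resolve_left (inv_ne_zero hK.volume_pos.ne')

theorem gauge_midpoint_le_one (hK : IsConvexBody K) (h0 : K ∈ 𝓝 0)
    {x y : EuclideanSpace ℝ (Fin n)} (hx : gauge K x ≤ 1) (hy : gauge K y ≤ 1) :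
    gauge K ((1 / 2 : ℝ) • (x + y)) ≤ 1 := by
  rw [gauge_smul_of_nonneg (by norm_num)]
  have := gauge_add_le hK.convex (absorbent_nhds_zero h0) x y
  simp only [smul_eq_mul]
  linarith

/-- The defining property of the modulus of convexity. -/
theorem gauge_midpoint_le_of_le_modulusOfConvexity (hK : IsConvexBody K) (h0 : K ∈ 𝓝 0) {r ε : ℝ}
    (hδ : r ≤ modulusOfConvexity K ε) {x y : EuclideanSpace ℝ (Fin n)} (hx : x ∈ K) (hy : y ∈ K)
    (hxy : ε ≤ gauge K (x - y)) : gauge K ((1 / 2 : ℝ) • (x + y)) ≤ 1 - r := by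
  -- A real `sInf` bounds the members of its set only when the set is bounded below; here 0 is a
  -- lower bound.
  have hb : BddBelow {d : ℝ | ∃ x y : EuclideanSpace ℝ (Fin n), gauge K x ≤ 1 ∧ gauge K y ≤ 1 ∧
      ε ≤ gauge K (x - y) ∧ d = 1 - gauge K ((1 / 2 : ℝ) • (x + y))} := by
    refine ⟨0, ?_⟩
    rintro _ ⟨x, y, hx, hy, -, rfl⟩
    linarith [gauge_midpoint_le_one hK h0 hx hy]
  have := hδ.trans (csInf_le hb
    ⟨x, y, gauge_le_one_of_mem hx, gauge_le_one_of_mem hy, hxy, rfl⟩)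
  linarith

theorem mem_smul_of_gauge_le (hK : IsConvexBody K) (h0 : K ∈ 𝓝 0) {t : ℝ} (ht : 0 < t)
    {x : EuclideanSpace ℝ (Fin n)} (hx : gauge K x ≤ t) : x ∈ t • K := by
  refine (mem_smul_set_iff_inv_smul_mem₀ ht.ne' _ _).2 ?_
  rw [← hK.isCompact.isClosed.closure_eq, ← gauge_le_one_iff_mem_closure hK.convex h0,
    gauge_smul_of_nonneg (inv_nonneg.2 ht.le), smul_eq_mul, inv_mul_le_one₀ ht]
  exact hx

theorem prod_restrict_univ :
    ((volume.restrict K).prod (volume.restrict K)).real univ = volume.real K ^ 2 := by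
  rw [measureReal_def, Measure.prod_apply MeasurableSet.univ]
  simp [measureReal_def, pow_two]

theorem isFiniteMeasure_prod_restrict (hK : IsCompact K) :
    IsFiniteMeasure ((volume.restrict K).prod (volume.restrict K)) := by
  have hf : IsFiniteMeasure (volume.restrict K) :=
    isFiniteMeasure_restrict.2 hK.measure_lt_top.ne
  infer_instance

theorem ae_prod_restrict_mem (hK : IsCompact K) :
    ∀ᵐ p ∂((volume.restrict K).prod (volume.restrict K)), p.1 ∈ K ∧ p.2 ∈ K := by
  rw [Measure.prod_restrict]
  exact ae_restrict_mem (hK.measurableSet.prod hK.measurableSet)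

theorem measurableSet_le_gauge_sub (hK : IsConvexBody K) (h0 : K ∈ 𝓝 0) (ε : ℝ) :
    MeasurableSet {p : EuclideanSpace ℝ (Fin n) × EuclideanSpace ℝ (Fin n) |
      ε ≤ gauge K (p.1 - p.2)} :=
  measurableSet_le measurable_const
    ((continuous_gauge hK.convex h0).measurable.comp (measurable_fst.sub measurable_snd))

theorem le_prod_restrict_le_gauge_sub (hK : IsConvexBody K) (h0 : K ∈ 𝓝 0) {ε : ℝ} (hε₀ : 0 < ε)
    (hε₁ : ε < √2) :
    (1 - Real.exp (-((√2 - ε) ^ 2 / 4 * n))) * volume.real K ^ 2 ≤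
      ((volume.restrict K).prod (volume.restrict K)).real {p | ε ≤ gauge K (p.1 - p.2)} := by
  have hf := isFiniteMeasure_prod_restrict hK.isCompact
  have hcompl := measureReal_add_measureReal_compl
    (μ := (volume.restrict K).prod (volume.restrict K)) (measurableSet_le_gauge_sub hK h0 ε)
  have hset : {p : EuclideanSpace ℝ (Fin n) × EuclideanSpace ℝ (Fin n) |
      ε ≤ gauge K (p.1 - p.2)}ᶜ = {p | gauge K (p.1 - p.2) < ε} := by
    ext p; simp
  have h := ENNReal.toReal_mono (by
    exact ENNReal.mul_ne_top ENNReal.ofReal_ne_top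
      (ENNReal.pow_ne_top hK.isCompact.measure_lt_top.ne))
    (prod_restrict_gauge_sub_lt_le hK h0 hε₀ hε₁)
  rw [ENNReal.toReal_mul, ENNReal.toReal_ofReal (Real.exp_pos _).le, ENNReal.toReal_pow] at h
  rw [hset, prod_restrict_univ] at hcompl
  simp only [measureReal_def] at *
  linarith

theorem volume_symmInter_le_kovnerBesicovitch (hK : IsConvexBody K)
    (z : EuclideanSpace ℝ (Fin n)) :
    volume ((K - {z}) ∩ ({z} - K)) ≤ ENNReal.ofReal (kovnerBesicovitch K * volume.real K) := by
  have h := hK.isGreatest_kovnerBesicovitch.2 (mem_range_self z)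
  rw [symmRatio, div_le_iff₀ hK.volume_pos] at h
  rw [← ENNReal.ofReal_toReal (isCompact_symmInter hK.isCompact z).measure_lt_top.ne]
  exact ENNReal.ofReal_le_ofReal h

theorem kovnerBesicovitch_nonneg (hK : IsConvexBody K) : 0 ≤ kovnerBesicovitch K :=
  le_trans (div_nonneg measureReal_nonneg measureReal_nonneg)
    (hK.isGreatest_kovnerBesicovitch.2 (mem_range_self 0))

theorem le_kovnerBesicovitch (hK : IsConvexBody K) (h0 : K ∈ 𝓝 0) {r ε : ℝ} (hr₁ : r < 1)
    (hε₀ : 0 < ε) (hε₁ : ε < √2) (hδ : r ≤ modulusOfConvexity K ε) :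
    (1 - Real.exp (-((√2 - ε) ^ 2 / 4 * n))) * volume.real K ^ 2 ≤
      2 ^ n * (kovnerBesicovitch K * volume.real K) * ((1 - r) ^ n * volume.real K) := by
  have h1r : 0 < 1 - r := by linarith
  have hf := isFiniteMeasure_prod_restrict hK.isCompact
  have hΔ := kovnerBesicovitch_nonneg hK
  refine (le_prod_restrict_le_gauge_sub hK h0 hε₀ hε₁).trans ?_
  have hA : MeasurableSet ((1 - r) • K) := hK.isCompact.measurableSet.const_smul₀ _
  have hmid : Measurable fun p : EuclideanSpace ℝ (Fin n) × EuclideanSpace ℝ (Fin n) =>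
      (1 / 2 : ℝ) • (p.1 + p.2) := by fun_prop
  have hle : ((volume.restrict K).prod (volume.restrict K)) {p | ε ≤ gauge K (p.1 - p.2)} ≤
      ENNReal.ofReal (2 ^ n * (kovnerBesicovitch K * volume.real K) *
        ((1 - r) ^ n * volume.real K)) := by
    calc _ ≤ ((volume.restrict K).prod (volume.restrict K))
            ((fun p => (1 / 2 : ℝ) • (p.1 + p.2)) ⁻¹' ((1 - r) • K)) := by
          refine measure_mono_ae ?_
          filter_upwards [ae_prod_restrict_mem hK.isCompact] with p hp hpε
          exact mem_smul_of_gauge_le hK h0 h1r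
            (gauge_midpoint_le_of_le_modulusOfConvexity hK h0 hδ hp.1 hp.2 hpε)
      _ = ∫⁻ z in (1 - r) • K, 2 ^ n * volume ((K - {z}) ∩ ({z} - K)) := by
          rw [← Measure.map_apply hmid hA, map_midpoint_prod_restrict hK.isCompact,
            withDensity_apply _ hA]
      _ ≤ ∫⁻ z in (1 - r) • K, 2 ^ n * ENNReal.ofReal (kovnerBesicovitch K * volume.real K) := by
          gcongr with z
          exact volume_symmInter_le_kovnerBesicovitch hK z
      _ = _ := by
          have hv : volume ((1 - r) • K) = ENNReal.ofReal ((1 - r) ^ n * volume.real K) := by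
            rw [Measure.addHaar_smul_of_nonneg _ h1r.le, ENNReal.ofReal_mul (by positivity),
              measureReal_def, ENNReal.ofReal_toReal hK.isCompact.measure_lt_top.ne]
            simp
          have h2 : (2 : ℝ≥0∞) ^ n = ENNReal.ofReal (2 ^ n) := by
            rw [ENNReal.ofReal_pow (by norm_num)]
            simp
          rw [setLIntegral_const, hv, h2, ← ENNReal.ofReal_mul (by positivity),
            ← ENNReal.ofReal_mul (by positivity)]
  exact ENNReal.toReal_le_of_le_ofReal (by positivity) hle

/-- Supporting hyperplane of a concave function at an interior point. -/
theorem ConcaveOn.exists_le_add_continuousLinearMap {E : Type*} [NormedAddCommGroup E]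
    [NormedSpace ℝ E] [FiniteDimensional ℝ E] {U : Set E} {ψ : E → ℝ} (hU : IsOpen U)
    (hψ : ConcaveOn ℝ U ψ) (h0 : (0 : E) ∈ U) : ∃ ℓ : E →L[ℝ] ℝ, ∀ z ∈ U, ψ z ≤ ψ 0 + ℓ z := by
  have hcont : ContinuousOn ψ U := by
    have := hψ.continuousOn_interior
    rwa [hU.interior_eq] at this
  have hopen : IsOpen {p : E × ℝ | p.1 ∈ U ∧ p.2 < ψ p.1} := by
    have h1 : ContinuousOn (fun p : E × ℝ => ψ p.1 - p.2) (U ×ˢ univ) :=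
      (hcont.comp continuousOn_fst fun p hp => hp.1).sub continuousOn_snd
    have h2 := h1.isOpen_inter_preimage (hU.prod isOpen_univ) (isOpen_Ioi (a := (0 : ℝ)))
    convert h2 using 1
    ext p
    simp
  -- The point (0, ψ 0) is separated from the open strict hypograph. The vertical coefficient `κ` is
  -- positive because points below it belong to the hypograph, so the hyperplane is a graph.
  obtain ⟨F, hF⟩ := geometric_hahn_banach_open_point hψ.convex_strict_hypograph hopen
    (x := ((0 : E), ψ 0)) (by simp)
  have hsplit : ∀ z s, F (z, s) = F (z, 0) + s * F (0, 1) := fun z s => by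
    have : ((z, s) : E × ℝ) = (z, 0) + s • ((0 : E), (1 : ℝ)) := by simp
    rw [this, map_add, map_smul, smul_eq_mul]
  set κ := F (0, 1) with hκ
  have hF0 : F ((0 : E), (0 : ℝ)) = 0 := map_zero F
  have hκ0 : 0 < κ := by
    have := hF (0, ψ 0 - 1) ⟨h0, by simp⟩
    rw [hsplit 0 (ψ 0 - 1), hsplit 0 (ψ 0)] at this
    linarith
  refine ⟨-(κ⁻¹ • F.comp (ContinuousLinearMap.inl ℝ E ℝ)), fun z hz => ?_⟩
  have hle : F (z, 0) + ψ z * κ ≤ ψ 0 * κ := by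
    refine le_of_forall_pos_lt_add fun η hη => ?_
    have := hF (z, ψ z - η / κ) ⟨hz, by simp; positivity⟩
    rw [hsplit z (ψ z - η / κ), hsplit 0 (ψ 0), hF0, sub_mul, div_mul_cancel₀ _ hκ0.ne'] at this
    linarith
  have e : (-(κ⁻¹ • F.comp (ContinuousLinearMap.inl ℝ E ℝ))) z = -(κ⁻¹ * F (z, 0)) := by simp
  rw [e]
  have h3 := mul_le_mul_of_nonneg_left hle (inv_nonneg.2 hκ0.le)
  have h4 : κ⁻¹ * (F (z, 0) + ψ z * κ) = κ⁻¹ * F (z, 0) + ψ z := by field_simp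
  have h5 : κ⁻¹ * (ψ 0 * κ) = ψ 0 := by field_simp
  linarith

theorem volume_symmInter_pos (hK : IsConvexBody K) {z : EuclideanSpace ℝ (Fin n)}
    (hz : z ∈ interior K) : 0 < volume.real ((K - {z}) ∩ ({z} - K)) := by
  have hzK : K ∈ 𝓝 z := mem_interior_iff_mem_nhds.1 hz
  have hmem : (K - {z}) ∩ ({z} - K) ∈ 𝓝 (0 : EuclideanSpace ℝ (Fin n)) := by
    have h1 : ∀ᶠ u in 𝓝 (0 : EuclideanSpace ℝ (Fin n)), u + z ∈ K :=
      (show Continuous fun u : EuclideanSpace ℝ (Fin n) => u + z by fun_prop).continuousAt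
        (by simpa using hzK)
    have h2 : ∀ᶠ u in 𝓝 (0 : EuclideanSpace ℝ (Fin n)), z - u ∈ K :=
      (show Continuous fun u : EuclideanSpace ℝ (Fin n) => z - u by fun_prop).continuousAt
        (by simpa using hzK)
    filter_upwards [h1, h2] with u hu1 hu2
    exact mem_symmInter.2 ⟨hu1, hu2⟩
  exact ENNReal.toReal_pos (Measure.measure_pos_of_mem_nhds _ hmem).ne'
    (isCompact_symmInter hK.isCompact z).measure_lt_top.ne

theorem volume_symmInter_eq_zero (hK : IsConvexBody K) {z : EuclideanSpace ℝ (Fin n)}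
    (hz : z ∉ K) : volume ((K - {z}) ∩ ({z} - K)) = 0 := by
  have : (K - {z}) ∩ ({z} - K) = ∅ := by
    refine eq_empty_of_forall_notMem fun u hu => hz ?_
    obtain ⟨h1, h2⟩ := mem_symmInter.1 hu
    convert hK.convex h1 h2 (a := 1 / 2) (b := 1 / 2) (by norm_num) (by norm_num) (by norm_num)
      using 1
    module
  rw [this, measure_empty]

/-- Logarithm of `volume_symmInter_logConcave`; on the interior the volumes are positive, so the
real logarithm is meaningful. -/
theorem concaveOn_log_volume_symmInter (hK : IsConvexBody K) :
    ConcaveOn ℝ (interior K) fun z => Real.log (volume.real ((K - {z}) ∩ ({z} - K))) := by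
  refine ⟨hK.convex.interior, fun x hx y hy a b ha hb hab => ?_⟩
  rcases ha.eq_or_lt with rfl | ha0
  · obtain rfl : b = 1 := by linarith
    simp
  rcases hb.eq_or_lt with rfl | hb0
  · obtain rfl : a = 1 := by linarith
    simp
  obtain rfl : b = 1 - a := by linarith
  have hfin : ∀ z, volume ((K - {z}) ∩ ({z} - K)) ≠ ∞ := fun z =>
    (isCompact_symmInter hK.isCompact z).measure_lt_top.ne
  have h := ENNReal.toReal_mono (hfin _) (volume_symmInter_logConcave hK ha0 (by linarith) x y)
  rw [ENNReal.toReal_mul, ← ENNReal.toReal_rpow, ← ENNReal.toReal_rpow] at h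
  have hxp := volume_symmInter_pos hK hx
  have hyp := volume_symmInter_pos hK hy
  have := Real.log_le_log (mul_pos (Real.rpow_pos_of_pos hxp _) (Real.rpow_pos_of_pos hyp _)) h
  rw [Real.log_mul (Real.rpow_pos_of_pos hxp _).ne' (Real.rpow_pos_of_pos hyp _).ne',
    Real.log_rpow hxp, Real.log_rpow hyp] at this
  exact this

/-- The exponential integral of a gauge, bounded by its value for the closed body. -/
theorem lintegral_exp_neg_gauge_le (hK : IsConvexBody K) (h0 : K ∈ 𝓝 0) {c : ℝ} (hc : 0 < c) :
    ∫⁻ z, ENNReal.ofReal (Real.exp (-(c * gauge K z))) ≤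
      ENNReal.ofReal (volume.real K * n.factorial / c ^ n) := by
  have hg : Measurable (gauge K) := (continuous_gauge hK.convex h0).measurable
  have hv := hK.volume_pos
  -- Writing e^{-cs} as the integral of c e^{-ct} over t > s reduces the gauge integral, by Tonelli,
  -- to volumes of dilates of `K` and a Gamma integral.
  have hinner : ∀ s : ℝ, ENNReal.ofReal (Real.exp (-(c * s))) =
      ∫⁻ t in Ioi s, ENNReal.ofReal (c * Real.exp (-c * t)) := fun s => by
    rw [← ofReal_integral_eq_lintegral_ofReal
      ((integrableOn_exp_mul_Ioi (neg_lt_zero.2 hc) s).const_mul c)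
      (Filter.Eventually.of_forall fun t => by positivity), integral_const_mul,
      integral_exp_mul_Ioi (neg_lt_zero.2 hc)]
    congr 1
    field_simp
  have hgam : ∫ t in Ioi (0 : ℝ), c * Real.exp (-c * t) * (t ^ n * volume.real K) =
      volume.real K * n.factorial / c ^ n := by
    have h := Real.integral_rpow_mul_exp_neg_mul_Ioi (a := n + 1) (by positivity) hc
    rw [Real.Gamma_nat_eq_factorial] at h
    have e : ∀ t : ℝ, c * Real.exp (-c * t) * (t ^ n * volume.real K) =
        (c * volume.real K) * (t ^ ((n : ℝ) + 1 - 1) * Real.exp (-(c * t))) := fun t => by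
      rw [add_sub_cancel_right, Real.rpow_natCast, neg_mul]; ring
    simp_rw [e]
    rw [integral_const_mul, h]
    have : (1 / c) ^ ((n : ℝ) + 1) = 1 / (c ^ n * c) := by
      rw [Real.rpow_add_one (by positivity), Real.rpow_natCast, div_pow, one_pow, div_mul_div_comm,
        one_mul]
    rw [this]
    field_simp
  calc ∫⁻ z, ENNReal.ofReal (Real.exp (-(c * gauge K z)))
      = ∫⁻ z, ∫⁻ t : ℝ, {p : EuclideanSpace ℝ (Fin n) × ℝ | gauge K p.1 < p.2}.indicator
          (fun p => ENNReal.ofReal (c * Real.exp (-c * p.2))) (z, t) := by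
        refine lintegral_congr fun z => ?_
        rw [hinner, ← lintegral_indicator measurableSet_Ioi]
        rfl
    _ = ∫⁻ t : ℝ, ∫⁻ z, {p : EuclideanSpace ℝ (Fin n) × ℝ | gauge K p.1 < p.2}.indicator
          (fun p => ENNReal.ofReal (c * Real.exp (-c * p.2))) (z, t) := by
        refine lintegral_lintegral_swap (Measurable.aemeasurable ?_)
        exact Measurable.indicator (by fun_prop)
          (measurableSet_lt (hg.comp measurable_fst) measurable_snd)
    _ ≤ ∫⁻ t : ℝ, (Ioi (0 : ℝ)).indicator (fun t => ENNReal.ofReal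
          (c * Real.exp (-c * t) * (t ^ n * volume.real K))) t := by
        refine lintegral_mono fun t => ?_
        by_cases ht : t ∈ Ioi (0 : ℝ)
        · have ht0 : 0 < t := ht
          rw [indicator_of_mem ht]
          calc ∫⁻ z, {p : EuclideanSpace ℝ (Fin n) × ℝ | gauge K p.1 < p.2}.indicator
                (fun p => ENNReal.ofReal (c * Real.exp (-c * p.2))) (z, t)
              = ∫⁻ z, {z | gauge K z < t}.indicator
                  (fun _ => ENNReal.ofReal (c * Real.exp (-c * t))) z := rfl
            _ = ENNReal.ofReal (c * Real.exp (-c * t)) * volume {z | gauge K z < t} :=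
                lintegral_indicator_const (measurableSet_lt hg measurable_const) _
            _ ≤ ENNReal.ofReal (c * Real.exp (-c * t)) * volume (t • K) := by
                gcongr
                exact fun z hz => mem_smul_of_gauge_le hK h0 ht (le_of_lt hz)
            _ = _ := by
                rw [ENNReal.ofReal_mul (p := c * _) (by positivity),
                  Measure.addHaar_smul_of_nonneg _ ht0.le, ENNReal.ofReal_mul (p := t ^ n) (by positivity),
                  measureReal_def, ENNReal.ofReal_toReal hK.isCompact.measure_lt_top.ne]
                simp
        · rw [indicator_of_notMem ht]
          refine le_of_eq (lintegral_eq_zero_of_ae_eq_zero (Filter.Eventually.of_forall fun z => ?_))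
          refine indicator_of_notMem (fun h => ht ?_) _
          exact (gauge_nonneg z).trans_lt h
    _ = _ := by
        rw [lintegral_indicator measurableSet_Ioi, ← hgam,
          ofReal_integral_eq_lintegral_ofReal]
        -- A non-integrable function has Bochner integral 0, so the positive value just computed
        -- yields integrability.
        · refine Integrable.of_integral_ne_zero ?_
          rw [hgam]
          positivity
        · refine (ae_restrict_iff' measurableSet_Ioi).2 (Filter.Eventually.of_forall fun t ht => ?_)
          have : (0 : ℝ) < t := ht
          simp only [Pi.zero_apply]
          positivity

end ConvexBodies

/-! ### Entropy argument for the symmetric intersection at the barycenter. -/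

section CenteredBodies

open scoped ENNReal

variable {n : ℕ} {K : Set (EuclideanSpace ℝ (Fin n))}

theorem integrable_prod_restrict_of_continuous (hK : IsCompact K)
    {F : EuclideanSpace ℝ (Fin n) × EuclideanSpace ℝ (Fin n) → ℝ} (hF : Continuous F) :
    Integrable F ((volume.restrict K).prod (volume.restrict K)) := by
  rw [Measure.prod_restrict]
  exact hF.continuousOn.integrableOn_compact (hK.prod hK)

theorem integral_midpoint_continuousLinearMap (hK : IsConvexBody K) (hc : barycenter K = 0)
    (ℓ : EuclideanSpace ℝ (Fin n) →L[ℝ] ℝ) :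
    ∫ p, ℓ ((1 / 2 : ℝ) • (p.1 + p.2)) ∂((volume.restrict K).prod (volume.restrict K)) = 0 := by
  have hℓ : ∫ x in K, ℓ x = 0 := by
    rw [ℓ.integral_comp_comm hK.integrableOn_id, hK.setIntegral_id_eq_zero hc, map_zero]
  have h1 : Integrable (fun p : EuclideanSpace ℝ (Fin n) × EuclideanSpace ℝ (Fin n) => ℓ p.1)
      ((volume.restrict K).prod (volume.restrict K)) :=
    integrable_prod_restrict_of_continuous hK.isCompact (by fun_prop)
  have h2 : Integrable (fun p : EuclideanSpace ℝ (Fin n) × EuclideanSpace ℝ (Fin n) => ℓ p.2)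
      ((volume.restrict K).prod (volume.restrict K)) :=
    integrable_prod_restrict_of_continuous hK.isCompact (by fun_prop)
  simp only [map_smul, map_add, smul_eq_mul]
  rw [integral_const_mul, integral_add h1 h2,
    integral_fun_fst (fun x => ℓ x), integral_fun_snd (fun x => ℓ x), hℓ]
  simp

/-- The midpoint has gauge at most 1 always and at most 1 - r when the two points are ε-apart;
integrate 1 minus r times the indicator of that event. -/
theorem integral_gauge_midpoint_le (hK : IsConvexBody K) (h0 : K ∈ 𝓝 0) {r ε : ℝ} (hr₀ : 0 < r)
    (hε₀ : 0 < ε) (hε₁ : ε < √2) (hδ : r ≤ modulusOfConvexity K ε) :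
    ∫ p, gauge K ((1 / 2 : ℝ) • (p.1 + p.2))
      ∂((volume.restrict K).prod (volume.restrict K)) ≤
      volume.real K ^ 2 * (1 - (1 - Real.exp (-((√2 - ε) ^ 2 / 4 * n))) * r) := by
  have hf := isFiniteMeasure_prod_restrict hK.isCompact
  have hB := measurableSet_le_gauge_sub hK h0 ε
  have hgc := continuous_gauge hK.convex h0
  set B : Set (EuclideanSpace ℝ (Fin n) × EuclideanSpace ℝ (Fin n)) :=
    {p | ε ≤ gauge K (p.1 - p.2)} with hBdef
  have hBi : Integrable (B.indicator fun _ => r)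
      ((volume.restrict K).prod (volume.restrict K)) := (integrable_const r).indicator hB
  have hle : ∫ p, gauge K ((1 / 2 : ℝ) • (p.1 + p.2))
      ∂((volume.restrict K).prod (volume.restrict K)) ≤
      ∫ p, (1 - B.indicator (fun _ => r) p)
        ∂((volume.restrict K).prod (volume.restrict K)) := by
    refine integral_mono_ae (integrable_prod_restrict_of_continuous hK.isCompact
      (hgc.comp (by fun_prop))) ((integrable_const 1).sub hBi) ?_
    filter_upwards [ae_prod_restrict_mem hK.isCompact] with p hp
    by_cases hpB : p ∈ B
    · rw [indicator_of_mem hpB]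
      exact gauge_midpoint_le_of_le_modulusOfConvexity hK h0 hδ hp.1 hp.2 hpB
    · rw [indicator_of_notMem hpB, sub_zero]
      exact gauge_midpoint_le_one hK h0 (gauge_le_one_of_mem hp.1) (gauge_le_one_of_mem hp.2)
  refine hle.trans ?_
  rw [integral_sub (integrable_const 1) hBi, integral_indicator_const r hB, integral_const,
    prod_restrict_univ]
  have := mul_le_mul_of_nonneg_left (le_prod_restrict_le_gauge_sub hK h0 hε₀ hε₁) hr₀.le
  simp only [smul_eq_mul, mul_one]
  linarith

/-- Gibbs' inequality for the midpoint density against an exponential density of the gauge. -/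
theorem log_le_log_volume_symmInter (hK : IsConvexBody K) (hc : barycenter K = 0) (h0 : K ∈ 𝓝 0)
    {c m : ℝ} (hc0 : 0 < c)
    (hm : ∫ p, gauge K ((1 / 2 : ℝ) • (p.1 + p.2))
      ∂((volume.restrict K).prod (volume.restrict K)) ≤ volume.real K ^ 2 * m) :
    Real.log (c ^ n / (n.factorial * volume.real K)) - c * m ≤
      Real.log (2 ^ n * volume.real ((K - {0}) ∩ ({0} - K)) / volume.real K ^ 2) := by
  have hv := hK.volume_pos
  have hf := isFiniteMeasure_prod_restrict hK.isCompact
  have hgc := continuous_gauge hK.convex h0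
  set μ := (volume.restrict K).prod (volume.restrict K) with hμ
  set σ : EuclideanSpace ℝ (Fin n) → ℝ :=
    fun z => volume.real ((K - {z}) ∩ ({z} - K)) with hσ
  have h0i : (0 : EuclideanSpace ℝ (Fin n)) ∈ interior K := mem_interior_iff_mem_nhds.2 h0
  have hσ0 : 0 < σ 0 := volume_symmInter_pos hK h0i
  obtain ⟨ℓ, hℓ⟩ := (concaveOn_log_volume_symmInter hK).exists_le_add_continuousLinearMap
    isOpen_interior h0i
  set A := c ^ n / (n.factorial * volume.real K) with hA
  set B := 2 ^ n * σ 0 / volume.real K ^ 2 with hB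
  have hA0 : 0 < A := by positivity
  have hB0 : 0 < B := by positivity
  -- This is 1 + log(q / (B e^ℓ)) with q = A exp(-c·gauge), where B e^ℓ majorises the midpoint
  -- density φ. From `1 + t ≤ exp t`, φ Y ≤ φ q / (B e^ℓ) ≤ q. Using the majorant instead of log φ
  -- keeps `Y` continuous, so no integrability of log φ is needed.
  set Y : EuclideanSpace ℝ (Fin n) → ℝ :=
    fun z => (Real.log A - Real.log B + 1) - c * gauge K z - ℓ z with hY
  have hYc : Continuous Y := by fun_prop
  have hmid : Measurable fun p : EuclideanSpace ℝ (Fin n) × EuclideanSpace ℝ (Fin n) =>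
      (1 / 2 : ℝ) • (p.1 + p.2) := by fun_prop
  have hmidc : Continuous fun p : EuclideanSpace ℝ (Fin n) × EuclideanSpace ℝ (Fin n) =>
      (1 / 2 : ℝ) • (p.1 + p.2) := by fun_prop
  have hpt : ∀ᵐ z, 2 ^ n * σ z * Y z ≤
      volume.real K ^ 2 * A * Real.exp (-(c * gauge K z)) := by
    -- The linear majorant is available only in the interior; the frontier of a convex set is null,
    -- and outside `K` the density vanishes.
    filter_upwards [measure_eq_zero_iff_ae_notMem.1 (hK.convex.addHaar_frontier volume)] with z hz
    by_cases hzK : z ∈ K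
    · have hzi : z ∈ interior K := by
        by_contra h
        exact hz ⟨subset_closure hzK, h⟩
      have hσz : 0 < σ z := volume_symmInter_pos hK hzi
      have hσle : σ z ≤ σ 0 * Real.exp (ℓ z) := by
        rw [← Real.exp_log hσz, ← Real.exp_log hσ0, ← Real.exp_add]
        exact Real.exp_le_exp.2 (hℓ z hzi)
      have hYe : Y z ≤ A / B * Real.exp (-(c * gauge K z)) * Real.exp (-ℓ z) := by
        have := Real.add_one_le_exp (Real.log A - Real.log B + -(c * gauge K z) + -ℓ z)
        rw [Real.exp_add, Real.exp_add, Real.exp_sub, Real.exp_log hA0, Real.exp_log hB0] at this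
        simp only [hY]
        linarith
      calc 2 ^ n * σ z * Y z
          ≤ 2 ^ n * σ z * (A / B * Real.exp (-(c * gauge K z)) * Real.exp (-ℓ z)) := by gcongr
        _ ≤ 2 ^ n * (σ 0 * Real.exp (ℓ z)) *
              (A / B * Real.exp (-(c * gauge K z)) * Real.exp (-ℓ z)) := by gcongr
        _ = volume.real K ^ 2 * A * Real.exp (-(c * gauge K z)) := by
            rw [hB, Real.exp_neg (ℓ z)]
            field_simp
    · have hσz : σ z = 0 := by
        simp only [hσ, measureReal_def, volume_symmInter_eq_zero hK hzK, ENNReal.toReal_zero]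
      rw [hσz, mul_zero, zero_mul]
      positivity
  have hmS : Measurable fun z => 2 ^ n * volume ((K - {z}) ∩ ({z} - K)) :=
    (measurable_volume_symmInter hK.isCompact).const_mul _
  have hfinS : ∀ᵐ z : EuclideanSpace ℝ (Fin n),
      2 ^ n * volume ((K - {z}) ∩ ({z} - K)) < ∞ :=
    Filter.Eventually.of_forall fun z => ENNReal.mul_lt_top (by simp)
      (isCompact_symmInter hK.isCompact z).measure_lt_top
  have hdens : ∀ z, (2 ^ n * volume ((K - {z}) ∩ ({z} - K))).toReal = 2 ^ n * σ z := fun z => by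
    rw [ENNReal.toReal_mul]
    simp [hσ, measureReal_def]
  have hYmid : Integrable (fun p => Y ((1 / 2 : ℝ) • (p.1 + p.2))) μ :=
    integrable_prod_restrict_of_continuous hK.isCompact (hYc.comp hmidc)
  have hint : ∫ p, Y ((1 / 2 : ℝ) • (p.1 + p.2)) ∂μ = ∫ z, 2 ^ n * σ z * Y z := by
    rw [← integral_map hmid.aemeasurable hYc.aestronglyMeasurable,
      map_midpoint_prod_restrict hK.isCompact,
      integral_withDensity_eq_integral_toReal_smul hmS hfinS]
    simp only [hdens, smul_eq_mul]
  have hintble : Integrable fun z => 2 ^ n * σ z * Y z := by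
    have h1 : Integrable Y (Measure.map (fun p => (1 / 2 : ℝ) • (p.1 + p.2)) μ) :=
      (integrable_map_measure hYc.aestronglyMeasurable hmid.aemeasurable).2 hYmid
    rw [map_midpoint_prod_restrict hK.isCompact,
      integrable_withDensity_iff_integrable_smul' hmS hfinS] at h1
    simpa only [hdens, smul_eq_mul] using h1
  have hexp_cont : Continuous fun z => Real.exp (-(c * gauge K z)) := by fun_prop
  have hexp_lint := lintegral_exp_neg_gauge_le hK h0 hc0
  have hexp : Integrable fun z => Real.exp (-(c * gauge K z)) := by
    refine ⟨hexp_cont.aestronglyMeasurable, ?_⟩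
    rw [hasFiniteIntegral_iff_ofReal (Filter.Eventually.of_forall fun z => (Real.exp_pos _).le)]
    exact hexp_lint.trans_lt ENNReal.ofReal_lt_top
  have hexp_le : ∫ z, Real.exp (-(c * gauge K z)) ≤ volume.real K * n.factorial / c ^ n := by
    rw [integral_eq_lintegral_of_nonneg_ae
      (Filter.Eventually.of_forall fun z => (Real.exp_pos _).le) hexp_cont.aestronglyMeasurable]
    exact ENNReal.toReal_le_of_le_ofReal (by positivity) hexp_lint
  have hupper : ∫ p, Y ((1 / 2 : ℝ) • (p.1 + p.2)) ∂μ ≤ volume.real K ^ 2 := by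
    calc _ = ∫ z, 2 ^ n * σ z * Y z := hint
      _ ≤ ∫ z, volume.real K ^ 2 * A * Real.exp (-(c * gauge K z)) :=
          integral_mono_ae hintble (hexp.const_mul _) hpt
      _ = volume.real K ^ 2 * A * ∫ z, Real.exp (-(c * gauge K z)) := integral_const_mul _ _
      _ ≤ volume.real K ^ 2 * A * (volume.real K * n.factorial / c ^ n) := by gcongr
      _ = volume.real K ^ 2 := by rw [hA]; field_simp
  have hlower : ∫ p, Y ((1 / 2 : ℝ) • (p.1 + p.2)) ∂μ =
      volume.real K ^ 2 * (Real.log A - Real.log B + 1) -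
        c * ∫ p, gauge K ((1 / 2 : ℝ) • (p.1 + p.2)) ∂μ := by
    have i1 : Integrable (fun p => c * gauge K ((1 / 2 : ℝ) • (p.1 + p.2))) μ :=
      integrable_prod_restrict_of_continuous hK.isCompact
        (continuous_const.mul (hgc.comp hmidc))
    have i2 : Integrable (fun p => ℓ ((1 / 2 : ℝ) • (p.1 + p.2))) μ :=
      integrable_prod_restrict_of_continuous hK.isCompact (ℓ.continuous.comp hmidc)
    have i3 : Integrable (fun p => Real.log A - Real.log B + 1 -
        c * gauge K ((1 / 2 : ℝ) • (p.1 + p.2))) μ := (integrable_const _).sub i1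
    simp only [hY]
    rw [integral_sub i3 i2, integral_sub (integrable_const _) i1,
      integral_const, integral_const_mul, integral_midpoint_continuousLinearMap hK hc ℓ,
      prod_restrict_univ, smul_eq_mul, sub_zero]
  have hcm := mul_le_mul_of_nonneg_left hm hc0.le
  have hfinal : volume.real K ^ 2 * (Real.log A - Real.log B - c * m) ≤ 0 := by
    rw [hlower] at hupper
    linarith
  have := nonpos_of_mul_nonpos_right hfinal (by positivity)
  linarith

end CenteredBodies

/-! ### Stirling's bound and the conclusion. -/

/-- The Stirling sequence n!/(√(2n) (n/e)ⁿ) decreases from index 1, where its value is e/√2. -/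
theorem factorial_le_stirling {n : ℕ} (hn : 1 ≤ n) :
    (n.factorial : ℝ) ≤ Real.exp 1 * √n * (n / Real.exp 1) ^ n := by
  obtain ⟨k, rfl⟩ : ∃ k, n = k + 1 := ⟨n - 1, by omega⟩
  have h := Stirling.stirlingSeq'_antitone (Nat.zero_le k)
  simp only [Function.comp_apply, Nat.succ_eq_add_one, zero_add, Stirling.stirlingSeq_one] at h
  have h2 : 0 < √2 := by positivity
  rw [Stirling.stirlingSeq, div_le_iff₀ (by positivity)] at h
  refine h.trans (le_of_eq ?_)
  rw [Real.sqrt_mul (by norm_num)]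
  field_simp

theorem theorem1p5 (n : ℕ) (r ε α : ℝ) (hr₀ : 0 < r) (hr₁ : r < 1) (hε₀ : 0 < ε)
    (hε₁ : ε < Real.sqrt 2)
    (hα : α = 1 - Real.exp (-((Real.sqrt 2 - ε) ^ 2 / 4 * (n : ℝ))))
    (K : Set (EuclideanSpace ℝ (Fin n))) (hK : IsConvexBody K) (hcentered : barycenter K = 0)
    (hδ : r ≤ modulusOfConvexity K ε) :
    kovnerBesicovitch K ≥ α * (2 : ℝ) ^ (-(n : ℤ)) * (1 / (1 - r)) ^ n ∧
      volume.real (K ∩ (-K)) / volume.real K ≥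
        1 / (Real.exp 1 * Real.sqrt n) * (2 : ℝ) ^ (-(n : ℤ)) * (1 / (1 - α * r)) ^ n := by
  have h0 : K ∈ 𝓝 0 := by
    have := hK.barycenter_mem_interior
    rw [hcentered] at this
    exact mem_interior_iff_mem_nhds.1 this
  have hv := hK.volume_pos
  have h1r : 0 < 1 - r := by linarith
  have hz : (2 : ℝ) ^ (-(n : ℤ)) = 1 / 2 ^ n := by rw [zpow_neg, zpow_natCast, one_div]
  rw [hz]
  constructor
  · have h := le_kovnerBesicovitch hK h0 hr₁ hε₀ hε₁ hδ
    rw [← hα] at h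
    have h' : α * volume.real K ^ 2 ≤
        (kovnerBesicovitch K * (2 ^ n * (1 - r) ^ n)) * volume.real K ^ 2 := by
      refine h.trans (le_of_eq ?_)
      ring
    have h'' := le_of_mul_le_mul_right h' (by positivity)
    rw [ge_iff_le, div_pow, one_pow, mul_assoc, div_mul_div_comm, one_mul, mul_one_div,
      div_le_iff₀ (by positivity)]
    exact h''
  -- In dimension 0 the factor `1 / (e * √0)` is 0 by the division convention, so the lower bound is
  -- trivial.
  · rcases Nat.eq_zero_or_pos n with rfl | hn
    · simp
      positivity
    have hα1 : α < 1 := by rw [hα]; linarith [Real.exp_pos (-((√2 - ε) ^ 2 / 4 * (n : ℝ)))]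
    have hm0 : 0 < 1 - α * r := by
      by_cases hα0 : 0 ≤ α
      · nlinarith
      · nlinarith
    have hm := integral_gauge_midpoint_le hK h0 hr₀ hε₀ hε₁ hδ
    rw [← hα] at hm
    have hn0 : (0 : ℝ) < n := by exact_mod_cast hn
    set m := 1 - α * r with hmdef
    -- The value c = n/m maximises n log c - c m.
    have hlog := log_le_log_volume_symmInter hK hcentered h0 (c := n / m) (by positivity) hm
    have hset : (K - {0}) ∩ ({0} - K) = K ∩ -K := by
      ext x
      rw [mem_symmInter]
      simp
    rw [hset, div_mul_cancel₀ _ hm0.ne'] at hlog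
    have hpos : 0 < volume.real (K ∩ -K) := by
      rw [← hset]
      exact volume_symmInter_pos hK (mem_interior_iff_mem_nhds.2 h0)
    have hexp := Real.exp_le_exp.2 hlog
    rw [Real.exp_sub, Real.exp_log (by positivity), Real.exp_log (by positivity)] at hexp
    have hst := factorial_le_stirling hn
    have hen : Real.exp (n : ℝ) = Real.exp 1 ^ n := by rw [← Real.exp_nat_mul, mul_one]
    rw [hen, div_div, div_le_div_iff₀ (by positivity) (by positivity), div_pow] at hexp
    rw [ge_iff_le, le_div_iff₀ hv, div_pow, one_pow]
    have hsn : 0 < √(n : ℝ) := Real.sqrt_pos.2 hn0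
    have hE := Real.exp_pos 1
    rw [div_pow, mul_div_assoc'] at hst
    rw [le_div_iff₀ (by positivity)] at hst
    generalize Real.exp 1 = e at *
    generalize volume.real (K ∩ -K) = s at *
    generalize volume.real K = v at *
    have hfac : (0 : ℝ) < n.factorial := by positivity
    have h3 : (n : ℝ) ^ n * v ≤ 2 ^ n * s * m ^ n * (n.factorial * e ^ n) := by
      rw [div_mul_eq_mul_div, div_le_iff₀ (by positivity)] at hexp
      have : (n : ℝ) ^ n * v * v ≤ 2 ^ n * s * m ^ n * (n.factorial * e ^ n) * v := by
        calc _ = _ := by ring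
          _ ≤ _ := hexp
          _ = _ := by ring
      exact le_of_mul_le_mul_right this hv
    have h4 : 2 ^ n * s * m ^ n * (n.factorial * e ^ n) ≤
        2 ^ n * s * m ^ n * (e * √n * n ^ n) := by gcongr
    have h5 : v * (n : ℝ) ^ n ≤ (2 ^ n * s * m ^ n * (e * √n)) * (n : ℝ) ^ n := by linarith
    have h6 := le_of_mul_le_mul_right h5 (by positivity)
    have h7 : 1 / (e * √n) * (1 / 2 ^ n) * (1 / m ^ n) * v = v / (2 ^ n * m ^ n * (e * √n)) := by
      field_simp
    rw [h7, div_le_iff₀ (by positivity)]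
    linarith
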